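/- Let $q_c,q_l>0$ with $2q_c+q_l\le 1$. For $\alpha\in(1,2)$ and $n\ge 1$ let $E$ be a uniformly random set of exactly $\lceil n^{2-\alpha}\rceil$ of the $\binom n2$ unordered pairs of distinct nodes in $\{0,\dots,n-1\}$ (model M2; the elements of $E$ are called long range edges and are added to the cycle on $0,\dots,n-1$; a pair that is an edge of the cycle may be chosen). "A.a.s." means with probability tending to $1$ as $n\to\infty$. Call a real number $d$ admissible for $\alpha$ if a.a.s. no node has more than $d$ long range edges. For real $r$ with $|r|\le q_c$ and an admissible $d=d(\alpha)$, the homogeneous chain moves from each node to its clockwise neighbour on the cycle with probability $q_c+r$, to its counterclockwise neighbour with probability $q_c-r$, along each long range edge at the node with probability $q_l/d$ (these probabilities are added if several of these moves lead to the same node), and otherwise stays put. With $\pi$ the uniform distribution, its conductance is $$\Phi=\min_{\emptyset\ne S\subsetneq\{0,\dots,n-1\}}\frac{\sum_{i\in S,\,j\notin S}\pi_i\,p_{ij}}{\pi(S)\,\pi(S^c)} .$$ Then there is a constant $c_1>0$, depending only on $q_c,q_l$, such that for every $\alpha\in(1,2)$ an admissible $d$ exists, and there is a constant $c_2>0$,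 depending only on $q_c,q_l,\alpha$, such that for every admissible $d=d(\alpha)$ and every real $r$ with $|r|\le q_c$, a.a.s. the transition matrix $(p_{ij})$ is doubly stochastic (so the uniform distribution is stationary) and $$c_1\,d(\alpha)^{-1}\,\frac{n^{1-\alpha}}{\log n}<\Phi<c_2\,\frac{n^{1-\alpha}}{\log n}.$$ -/

import Mathlib

open Filter Topology

noncomputable section

namespace CycleM2

/-- The flow `Q(A, B) = ∑_{i ∈ A, j ∈ B} π_i p_{ij}`. -/
def flow {V : Type*} (π : V → ℝ) (P : Matrix V V ℝ) (A B : Finset V) : ℝ :=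
  ∑ i ∈ A, ∑ j ∈ B, π i * P i j

open scoped Classical in
/-- The conductance of the transition matrix `P` with stationary distribution `π`: the minimum of
`Q(S, Sᶜ) / (π(S) π(Sᶜ))` over all nonempty proper subsets `S` of the finite state space. The
infimum runs over finitely many sets, so it is a minimum as soon as there are two states. -/
def conductance {V : Type*} [Fintype V] (π : V → ℝ) (P : Matrix V V ℝ) : ℝ :=
  ⨅ S : {S : Finset V // S.Nonempty ∧ S ≠ Finset.univ},
    flow π P S.1 S.1ᶜ / ((∑ i ∈ S.1, π i) * ∑ i ∈ S.1ᶜ, π i)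

/-- The uniform distribution on `n` states. -/
def uniformDist (n : ℕ) : Fin n → ℝ := fun _ => (n : ℝ)⁻¹

/-- The uniform distribution is stationary for every doubly stochastic matrix. -/
theorem uniformDist_vecMul {n : ℕ} {P : Matrix (Fin n) (Fin n) ℝ}
    (hP : P ∈ doublyStochastic ℝ (Fin n)) :
    Matrix.vecMul (uniformDist n) P = uniformDist n := by
  funext j
  have h := sum_col_of_mem_doublyStochastic hP j
  simp only [Matrix.vecMul, dotProduct, uniformDist]
  rw [← Finset.mul_sum, h, mul_one]

/-- `j` is the clockwise neighbour of `i` on the cycle with nodes `0, …, n - 1`. -/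
def IsNext {n : ℕ} (i j : Fin n) : Prop := (i.val + 1) % n = j.val

open scoped Classical in
/-- Transition probability from `i` to a different node `j` of the homogeneous chain with long
range edge set `E`. If a long range edge coincides with an edge of the cycle, the two transition
probabilities add up. -/
def moveProb {n : ℕ} (qc ql r d : ℝ) (E : Finset (Sym2 (Fin n))) (i j : Fin n) : ℝ :=
  (if IsNext i j then qc + r else 0) + (if IsNext j i then qc - r else 0) +
    (if s(i, j) ∈ E then ql / d else 0)

/-- The transition matrix of the homogeneous chain: with the remaining probability it stays put. -/
def homogeneousChain {n : ℕ} (qc ql r d : ℝ) (E : Finset (Sym2 (Fin n))) :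
    Matrix (Fin n) (Fin n) ℝ := fun i j =>
  if i = j then 1 - ∑ k ∈ Finset.univ.erase i, moveProb qc ql r d E i k
  else moveProb qc ql r d E i j

open scoped Classical in
/-- The number of long range edges at the node `i`. -/
def longDegree {n : ℕ} (E : Finset (Sym2 (Fin n))) (i : Fin n) : ℕ :=
  (E.filter fun e => i ∈ e).card

/-- The sample space of the model M2 on `n` nodes: all sets of exactly `⌈n ^ (2 - α)⌉` long range
edges, a long range edge being any of the `n.choose 2` unordered pairs of distinct nodes. -/
def sampleM2 (α : ℝ) (n : ℕ) : Finset (Finset (Sym2 (Fin n))) :=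
  (⊤ : SimpleGraph (Fin n)).edgeFinset.powersetCard ⌈(n : ℝ) ^ (2 - α)⌉₊

open scoped Classical in
/-- The probability of the event `A` when the long range edge set is uniform on `sampleM2 α n`. -/
def probM2 (α : ℝ) (n : ℕ) (A : Finset (Sym2 (Fin n)) → Prop) : ℝ :=
  (((sampleM2 α n).filter A).card : ℝ) / ((sampleM2 α n).card : ℝ)

/-- The sequence of events `A n` holds asymptotically almost surely in the model M2. -/
def AasM2 (α : ℝ) (A : (n : ℕ) → Finset (Sym2 (Fin n)) → Prop) : Prop :=
  Tendsto (fun n : ℕ => probM2 α n (A n)) atTop (𝓝 1)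

/-- `d` is an admissible value of `d(α)`: a.a.s. no node has more than `d` long range edges. -/
def IsDegreeBoundM2 (α d : ℝ) : Prop :=
  AasM2 α fun _ E => ∀ i, (longDegree E i : ℝ) ≤ d

end CycleM2

end

/-! For a set S let k be the number of nodes of S whose clockwise neighbour lies outside, and e the
number of long range edges crossing the cut. The cycle is left and entered equally often, so the
drift r cancels and the quotient of S is n(2 qc k + (ql/d) e) / (|S||Sᶜ|) (`flow_div_eq`). Both
bounds become statements about k and e.

Lower bound: put μ = |S||Sᶜ| n^(-α). It suffices that k + e ≥ μ/(6 log n) for all S. This is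
automatic if 6k log n ≥ μ. Otherwise e has mean at least 2μ, and the exponential moment at θ = 1/2
bounds the failure probability by 2n^(-5k). A set is determined by its exits, its entries and
whether it contains 0, so at most 2(n choose k)² sets have a given k, and the union bound is O(1/n)
(`aasM2_card_exits_add_card_inter_cut`).

Upper bound: cut out disjoint arcs of length about c n^(α-1) log n. Each avoids all long range edges
with probability at least n^(-(2-α)/2) for small c, while there are of order n^(2-α)/log n arcs. The
expected number of isolated arcs tends to infinity and these events are nonpositively correlated, so
Chebyshev gives an isolated arc a.a.s. (`aasM2_exists_arc`). Its quotient has k ≤ 1 and e = 0, which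
is why d is absent from the upper bound.

The edges of E are not independent. Comparing elementary symmetric sums with powers recovers
binomial-type exponential moments up to a factor 2 (`sum_powersetCard_pow_card_inter_le`), which
also yields a constant degree bound. -/

namespace CycleM2

/-! ### Moment inequalities for uniform m-element subsets -/

/-- An elementary symmetric sum is at most the corresponding power sum divided by a factorial. -/
theorem factorial_mul_sum_powersetCard_prod_le {ι : Type*} (w : ι → ℝ) (hw : ∀ x, 0 ≤ w x)
    (U : Finset ι) (m : ℕ) :
    (m.factorial : ℝ) * ∑ E ∈ U.powersetCard m, ∏ x ∈ E, w x ≤ (∑ x ∈ U, w x) ^ m := by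
  classical
  induction U using Finset.induction_on generalizing m with
  | empty =>
    rcases m with _ | m
    · simp
    · rw [Finset.powersetCard_eq_empty.2 (by simp)]
      simp
  | insert a U ha ih =>
    rcases m with _ | m
    · simp
    · have hdisj : Disjoint (U.powersetCard (m + 1)) ((U.powersetCard m).image (insert a)) := by
        rw [Finset.disjoint_left]
        intro s hs hs'
        obtain ⟨t, -, rfl⟩ := Finset.mem_image.1 hs'
        exact ha ((Finset.mem_powersetCard.1 hs).1 (Finset.mem_insert_self a t))
      have hnot : ∀ t ∈ U.powersetCard m, a ∉ t := fun t ht h =>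
        ha ((Finset.mem_powersetCard.1 ht).1 h)
      rw [Finset.powersetCard_succ_insert ha, Finset.sum_union hdisj, Finset.sum_image,
        Finset.sum_insert ha]
      · have h1 : ∑ t ∈ U.powersetCard m, ∏ x ∈ insert a t, w x =
            w a * ∑ t ∈ U.powersetCard m, ∏ x ∈ t, w x := by
          rw [Finset.mul_sum]
          exact Finset.sum_congr rfl fun t ht => Finset.prod_insert (hnot t ht)
        have hW : 0 ≤ ∑ x ∈ U, w x := Finset.sum_nonneg fun x _ => hw x
        -- The first two terms of the binomial expansion account for the subsets avoiding `a` and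
        -- those containing it.
        have h2 : (∑ x ∈ U, w x) ^ (m + 1) + (m + 1) * w a * (∑ x ∈ U, w x) ^ m ≤
            (w a + ∑ x ∈ U, w x) ^ (m + 1) := by
          have h := pow_add_mul_le_add_pow_of_sq_nonneg hW (sq_nonneg (w a)) (sq_nonneg _)
            (by linarith [hw a]) (m + 1)
          rw [add_comm (w a)]
          refine le_trans (le_of_eq ?_) h
          push_cast
          simp
          ring
        have h3 := ih (m + 1)
        have h4 := mul_le_mul_of_nonneg_left (ih m)
          (mul_nonneg (by positivity : (0 : ℝ) ≤ m + 1) (hw a))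
        rw [h1]
        rw [Nat.factorial_succ] at h3 ⊢
        push_cast at h3 ⊢
        nlinarith
      · intro s hs t ht hst
        rw [← Finset.erase_insert (hnot s hs), ← Finset.erase_insert (hnot t ht)]
        exact congrArg (fun u => u.erase a) hst

/-- Exponential moments of the hypergeometric distribution. -/
theorem sum_powersetCard_pow_card_inter_le {ι : Type*} [DecidableEq ι] {U B : Finset ι}
    (hB : B ⊆ U) {m : ℕ} (hm : 2 * m ^ 2 ≤ U.card) (hU : 0 < U.card) {θ : ℝ} (hθ : 0 ≤ θ) :
    ∑ E ∈ U.powersetCard m, θ ^ (E ∩ B).card ≤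
      2 * Real.exp ((θ - 1) * (B.card * m / U.card)) * (U.powersetCard m).card := by
  have h1 := factorial_mul_sum_powersetCard_prod_le (fun x => if x ∈ B then θ else 1)
    (fun x => by split_ifs <;> simp [hθ]) U m
  have h2 : ∀ E : Finset ι, ∏ x ∈ E, (if x ∈ B then θ else 1) = θ ^ (E ∩ B).card := by
    intro E
    rw [Finset.prod_ite, Finset.prod_const, Finset.prod_const_one, mul_one,
      Finset.filter_mem_eq_inter]
  have h3 : ∑ x ∈ U, (if x ∈ B then θ else 1) = U.card * (1 + (θ - 1) * (B.card / U.card)) := by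
    have : ∀ x, (if x ∈ B then θ else 1) = 1 + (if x ∈ B then θ - 1 else 0) := by
      intro x; split_ifs <;> ring
    simp_rw [this]
    rw [Finset.sum_add_distrib, ← Finset.sum_filter, Finset.filter_mem_eq_inter,
      Finset.inter_eq_right.2 hB]
    have : (U.card : ℝ) ≠ 0 := by positivity
    simp
    field_simp
  simp_rw [h2] at h1
  rw [h3, mul_pow] at h1
  have hU' : (0 : ℝ) < U.card := by exact_mod_cast hU
  have h4 : (1 + (θ - 1) * (B.card / U.card)) ^ m ≤ Real.exp ((θ - 1) * (B.card * m / U.card)) := by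
    have hb : (B.card : ℝ) / U.card ≤ 1 :=
      (div_le_one hU').2 (by exact_mod_cast Finset.card_le_card hB)
    have hb0 : (0 : ℝ) ≤ (B.card : ℝ) / U.card := by positivity
    have h0 : 0 ≤ 1 + (θ - 1) * (B.card / U.card) := by nlinarith
    calc _ ≤ (Real.exp ((θ - 1) * (B.card / U.card))) ^ m := by
          apply pow_le_pow_left₀ h0
          rw [add_comm]
          exact Real.add_one_le_exp _
      _ = _ := by rw [← Real.exp_nat_mul]; congr 1; ring
  -- The factor 2 is the price of sampling without replacement: by Bernoulli, (1 - m/|U|)^m ≥ 1 -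
  -- m²/|U| ≥ 1/2.
  have h5 : (U.card : ℝ) ^ m ≤ 2 * (m.factorial * (U.powersetCard m).card) := by
    rw [Finset.card_powersetCard]
    have hd : ((U.card + 1 - m) ^ m : ℕ) ≤ m.factorial * U.card.choose m := by
      rw [← Nat.descFactorial_eq_factorial_mul_choose]
      exact Nat.pow_sub_le_descFactorial _ _
    have hd' : ((U.card : ℝ) - m) ^ m ≤ m.factorial * U.card.choose m := by
      have hmU : m ≤ U.card := by nlinarith
      calc ((U.card : ℝ) - m) ^ m = ((U.card - m : ℕ) : ℝ) ^ m := by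
            rw [Nat.cast_sub hmU]
        _ ≤ ((U.card + 1 - m : ℕ) : ℝ) ^ m := by
            gcongr; omega
        _ ≤ _ := by exact_mod_cast hd
    have hbern : 1 + (m : ℝ) * (-(m / U.card)) ≤ (1 + (-(m / U.card) : ℝ)) ^ m := by
      apply one_add_mul_le_pow
      have : (m : ℝ) / U.card ≤ 1 := (div_le_one hU').2 (by exact_mod_cast (by nlinarith))
      linarith
    have hhalf : (m : ℝ) * (m / U.card) ≤ 1 / 2 := by
      have : (2 : ℝ) * m ^ 2 ≤ U.card := by exact_mod_cast hm
      rw [← mul_div_assoc, div_le_iff₀ hU']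
      nlinarith
    have he : ((U.card : ℝ) - m) ^ m = U.card ^ m * (1 + (-(m / U.card) : ℝ)) ^ m := by
      rw [← mul_pow]; congr 1; field_simp; ring
    rw [he] at hd'
    have : (U.card : ℝ) ^ m * (1 / 2) ≤ U.card ^ m * (1 + (-(m / U.card) : ℝ)) ^ m := by
      gcongr; linarith
    linarith
  have hf : (0 : ℝ) < m.factorial := by positivity
  refine le_of_mul_le_mul_left (h1.trans ?_) hf
  calc (U.card : ℝ) ^ m * (1 + (θ - 1) * (B.card / U.card)) ^ m
      ≤ (U.card : ℝ) ^ m * Real.exp ((θ - 1) * (B.card * m / U.card)) := by gcongr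
    _ ≤ (2 * (m.factorial * (U.powersetCard m).card)) *
          Real.exp ((θ - 1) * (B.card * m / U.card)) := by gcongr
    _ = _ := by ring

/-- Chebyshev's inequality for pairwise nonpositively correlated equiprobable events: few points
lie in none of the sets `A j`. -/
theorem card_filter_forall_notMem_mul_le {Ω κ : Type*} [DecidableEq Ω] (T : Finset Ω) (J : Finset κ)
    (A : κ → Finset Ω) (hA : ∀ j ∈ J, A j ⊆ T) (a : ℕ) (ha : ∀ j ∈ J, (A j).card = a)
    (hAA : ∀ i ∈ J, ∀ j ∈ J, i ≠ j → (A i ∩ A j).card * T.card ≤ a ^ 2) :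
    (T.filter fun x => ∀ j ∈ J, x ∉ A j).card * (J.card * a) ≤ T.card ^ 2 := by
  classical
  rcases Nat.eq_zero_or_pos T.card with hT | hT
  · have : T = ∅ := Finset.card_eq_zero.1 hT
    simp [this]
  rcases Nat.eq_zero_or_pos (J.card * a) with hJ | hJ
  · simp [hJ]
  set X : Ω → ℝ := fun x => ∑ j ∈ J, if x ∈ A j then 1 else 0 with hX
  have hind : ∀ B ⊆ T, ∑ x ∈ T, (if x ∈ B then (1 : ℝ) else 0) = B.card := by
    intro B hB
    rw [← Finset.sum_filter, Finset.filter_mem_eq_inter, Finset.inter_eq_right.2 hB]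
    simp
  have h1 : ∑ x ∈ T, X x = J.card * a := by
    rw [hX, Finset.sum_comm, Finset.sum_congr rfl fun j hj => (hind _ (hA j hj)).trans (by
      rw [ha j hj])]
    simp
  have hT' : (0 : ℝ) < T.card := by exact_mod_cast hT
  have h2 : ∑ x ∈ T, X x ^ 2 ≤ J.card * a + J.card ^ 2 * (a ^ 2 / T.card) := by
    have : ∀ x, X x ^ 2 = ∑ i ∈ J, ∑ j ∈ J, if x ∈ A i ∩ A j then (1 : ℝ) else 0 := by
      intro x
      rw [hX, sq, Finset.sum_mul_sum]
      refine Finset.sum_congr rfl fun i _ => Finset.sum_congr rfl fun j _ => ?_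
      by_cases hi : x ∈ A i <;> by_cases hj : x ∈ A j <;> simp [hi, hj]
    simp_rw [this]
    rw [Finset.sum_comm]
    calc _ = ∑ i ∈ J, ∑ j ∈ J, ((A i ∩ A j).card : ℝ) := by
          refine Finset.sum_congr rfl fun i hi => ?_
          rw [Finset.sum_comm]
          exact Finset.sum_congr rfl fun j hj =>
            hind _ (Finset.inter_subset_left.trans (hA i hi))
      _ ≤ ∑ i ∈ J, ∑ j ∈ J, ((if i = j then (a : ℝ) else 0) + a ^ 2 / T.card) := by
          refine Finset.sum_le_sum fun i hi => Finset.sum_le_sum fun j hj => ?_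
          by_cases hij : i = j
          · subst hij
            rw [Finset.inter_self, ha i hi, if_pos rfl]
            have : (0 : ℝ) ≤ a ^ 2 / T.card := by positivity
            linarith
          · rw [if_neg hij, zero_add, le_div_iff₀ hT']
            exact_mod_cast hAA i hi j hj hij
      _ = _ := by
          simp only [Finset.sum_add_distrib, Finset.sum_ite_eq, Finset.sum_const, nsmul_eq_mul,
            Finset.sum_ite_mem, Finset.inter_self]
          ring
  set c : ℝ := J.card * a / T.card with hc
  -- The variance is at most the mean: only the diagonal pairs exceed the square of the mean `c`. A
  -- point with X = 0 contributes c² to this sum.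
  have h3 : ∑ x ∈ T, (X x - c) ^ 2 ≤ J.card * a := by
    have : ∑ x ∈ T, (X x - c) ^ 2 = ∑ x ∈ T, X x ^ 2 - 2 * c * ∑ x ∈ T, X x + T.card * c ^ 2 := by
      rw [Finset.mul_sum, ← Finset.sum_sub_distrib, ← nsmul_eq_mul, ← Finset.sum_const,
        ← Finset.sum_add_distrib]
      exact Finset.sum_congr rfl fun x _ => by ring
    rw [this, h1]
    have h5 : 2 * c * (J.card * a) - T.card * c ^ 2 = J.card ^ 2 * (a ^ 2 / T.card) := by
      rw [hc]; field_simp; ring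
    linarith
  have h4 : (T.filter fun x => ∀ j ∈ J, x ∉ A j).card * c ^ 2 ≤ ∑ x ∈ T, (X x - c) ^ 2 := by
    rw [← nsmul_eq_mul, ← Finset.sum_const]
    refine (Finset.sum_le_sum fun x hx => ?_).trans
      (Finset.sum_le_sum_of_subset_of_nonneg (Finset.filter_subset _ _) fun x _ _ => sq_nonneg _)
    have : X x = 0 := Finset.sum_eq_zero fun j hj => if_neg ((Finset.mem_filter.1 hx).2 j hj)
    rw [this, zero_sub, neg_sq]
  have hJ' : (0 : ℝ) < J.card * a := by exact_mod_cast hJ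
  have h6 := h4.trans h3
  have h7 : ((T.filter fun x => ∀ j ∈ J, x ∉ A j).card * (J.card * a) : ℝ) ≤ T.card ^ 2 := by
    refine le_of_mul_le_mul_right ?_ hJ'
    have : ((T.filter fun x => ∀ j ∈ J, x ∉ A j).card * (J.card * a) : ℝ) * (J.card * a) =
        ((T.filter fun x => ∀ j ∈ J, x ∉ A j).card * c ^ 2) * T.card ^ 2 := by
      rw [hc]; field_simp
    rw [this, mul_comm ((T.card : ℝ) ^ 2)]
    gcongr
  exact_mod_cast h7

/-- Factor by factor in the descending factorials: ac ≤ b² and 2b ≤ a + c pass to a - t, b - t, c -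
t. It supplies the nonpositive correlation of isolated arcs. -/
theorem choose_mul_choose_le_sq {a b c : ℕ} (h1 : a * c ≤ b ^ 2) (h2 : 2 * b ≤ a + c) (m : ℕ) :
    a.choose m * c.choose m ≤ b.choose m ^ 2 := by
  have key : a.descFactorial m * c.descFactorial m ≤ b.descFactorial m ^ 2 := by
    induction m with
    | zero => simp
    | succ m ih =>
      rw [Nat.descFactorial_succ, Nat.descFactorial_succ, Nat.descFactorial_succ, mul_pow]
      have : (a - m) * (c - m) ≤ (b - m) ^ 2 := by
        rcases Nat.lt_or_ge a m with ha | ha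
        · simp [Nat.sub_eq_zero_of_le ha.le]
        rcases Nat.lt_or_ge c m with hc | hc
        · simp [Nat.sub_eq_zero_of_le hc.le]
        have hb : m ≤ b := by nlinarith
        zify [ha, hb, hc]
        zify at h1 h2
        nlinarith
      calc _ = ((a - m) * (c - m)) * (a.descFactorial m * c.descFactorial m) := by ring
        _ ≤ _ := Nat.mul_le_mul this ih
  simp only [Nat.descFactorial_eq_factorial_mul_choose] at key
  have hf : 0 < m.factorial ^ 2 := by positivity
  refine Nat.le_of_mul_le_mul_left ?_ hf
  calc _ = m.factorial * a.choose m * (m.factorial * c.choose m) := by ring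
    _ ≤ _ := key
    _ = _ := by ring

/-! ### Boundaries of node sets on the cycle -/

/-- The nodes of `S` whose clockwise neighbour is not in `S`. -/
def exits {n : ℕ} [NeZero n] (S : Finset (Fin n)) : Finset (Fin n) :=
  Finset.univ.filter fun i => i ∈ S ∧ i + 1 ∉ S

/-- The nodes outside `S` whose clockwise neighbour is in `S`. -/
def entries {n : ℕ} [NeZero n] (S : Finset (Fin n)) : Finset (Fin n) :=
  Finset.univ.filter fun i => i ∉ S ∧ i + 1 ∈ S

/-- The unordered pairs with exactly one node in `S`. -/
def cut {V : Type*} [Fintype V] [DecidableEq V] (S : Finset V) : Finset (Sym2 V) :=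
  (S ×ˢ Sᶜ).image fun p => s(p.1, p.2)

/-- Each side is |S| minus the number of i with i and i + 1 both in S, because the shift preserves
cardinality. -/
theorem card_exits_eq_card_entries {n : ℕ} [NeZero n] (S : Finset (Fin n)) :
    (exits S).card = (entries S).card := by
  have h1 : (Finset.univ.filter fun i : Fin n => i + 1 ∈ S).card = S.card := by
    rw [← Finset.card_map (Equiv.addRight (1 : Fin n)).toEmbedding]
    congr 1
    ext i
    simp only [Finset.mem_map, Finset.mem_filter, Finset.mem_univ, true_and,
      Equiv.coe_toEmbedding, Equiv.coe_addRight]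
    exact ⟨fun ⟨a, ha, h⟩ => h ▸ ha, fun h => ⟨i - 1, by simpa using h, by simp⟩⟩
  have h2 : S.filter (fun i => i + 1 ∉ S) = exits S := by ext i; simp [exits]
  have h3 := Finset.card_filter_add_card_filter_not (s := S) (fun i => i + 1 ∈ S)
  have h4 := Finset.card_filter_add_card_filter_not
    (s := Finset.univ.filter fun i : Fin n => i + 1 ∈ S) (fun i => i ∈ S)
  have h5 : (Finset.univ.filter fun i : Fin n => i + 1 ∈ S).filter (fun i => i ∈ S) =
      S.filter (fun i => i + 1 ∈ S) := by ext i; simp [and_comm]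
  have h6 : (Finset.univ.filter fun i : Fin n => i + 1 ∈ S).filter (fun i => i ∉ S) =
      entries S := by ext i; simp [entries, and_comm]
  rw [h2] at h3
  rw [h5, h6] at h4
  omega

open scoped Fin.NatCast in
-- Walking clockwise from 0, membership changes exactly at exits and entries.
theorem eq_of_exits_eq_of_entries_eq {n : ℕ} [NeZero n] {S T : Finset (Fin n)}
    (h0 : 0 ∈ S ↔ 0 ∈ T) (h1 : exits S = exits T) (h2 : entries S = entries T) : S = T := by
  have key : ∀ k : ℕ, ((k : Fin n) ∈ S ↔ (k : Fin n) ∈ T) := by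
    intro k
    induction k with
    | zero => simpa using h0
    | succ k ih =>
      have h3 := Finset.ext_iff.1 h1 (k : Fin n)
      have h4 := Finset.ext_iff.1 h2 (k : Fin n)
      simp only [exits, entries, Finset.mem_filter, Finset.mem_univ, true_and] at h3 h4
      push_cast
      tauto
  ext i
  simpa using key i.val

theorem exits_nonempty {n : ℕ} [NeZero n] {S : Finset (Fin n)} (hS : S.Nonempty)
    (hS' : S ≠ Finset.univ) : (exits S).Nonempty := by
  rw [Finset.nonempty_iff_ne_empty]
  intro h
  have h' : entries S = ∅ := by
    rw [← Finset.card_eq_zero, ← card_exits_eq_card_entries, h, Finset.card_empty]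
  by_cases h0 : (0 : Fin n) ∈ S
  · exact hS' (eq_of_exits_eq_of_entries_eq (by simpa using h0)
      (by rw [h]; simp [exits]) (by rw [h']; simp [entries]))
  · exact hS.ne_empty (eq_of_exits_eq_of_entries_eq (by simpa using h0)
      (by rw [h]; simp [exits]) (by rw [h']; simp [entries]))

/-- Generating function form of the count of sets by boundary size. Forgetting that exits and
entries are equinumerous lets the sum factor. -/
theorem sum_pow_card_exits_add_card_entries_le (n : ℕ) [NeZero n] {x : ℝ} (hx : 0 ≤ x) :
    ∑ S : Finset (Fin n), x ^ ((exits S).card + (entries S).card) ≤ 2 * (1 + x) ^ (2 * n) := by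
  have hsum : ∑ D : Finset (Fin n), x ^ D.card = (1 + x) ^ n := by
    have := Finset.sum_pow_mul_eq_add_pow x 1 (Finset.univ : Finset (Fin n))
    simp only [one_pow, mul_one, Finset.powerset_univ, Finset.card_univ, Fintype.card_fin] at this
    rw [this, add_comm]
  let f : Finset (Fin n) → Bool × Finset (Fin n) × Finset (Fin n) :=
    fun S => (decide (0 ∈ S), exits S, entries S)
  have hf : Function.Injective f := by
    intro S T h
    simp only [f, Prod.mk.injEq, decide_eq_decide] at h
    exact eq_of_exits_eq_of_entries_eq h.1 h.2.1 h.2.2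
  calc ∑ S : Finset (Fin n), x ^ ((exits S).card + (entries S).card)
      = ∑ p ∈ Finset.univ.image f, x ^ (p.2.1.card + p.2.2.card) := by
        rw [Finset.sum_image fun a _ b _ h => hf h]
    _ ≤ ∑ p : Bool × Finset (Fin n) × Finset (Fin n), x ^ (p.2.1.card + p.2.2.card) :=
        Finset.sum_le_sum_of_subset_of_nonneg (Finset.subset_univ _) fun _ _ _ => by positivity
    _ = 2 * (1 + x) ^ (2 * n) := by
        rw [Fintype.sum_prod_type]
        simp only [Fintype.sum_prod_type, pow_add, ← Finset.mul_sum, ← Finset.sum_mul, hsum]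
        simp
        ring

theorem cut_injOn {V : Type*} [Fintype V] [DecidableEq V] (S : Finset V) :
    Set.InjOn (fun p : V × V => s(p.1, p.2)) (S ×ˢ Sᶜ : Finset (V × V)) := by
  rintro ⟨a, b⟩ hab ⟨c, d⟩ hcd h
  simp only [Finset.coe_product, Set.mem_prod, Finset.mem_coe, Finset.mem_compl] at hab hcd
  simp only [Sym2.eq_iff] at h
  rcases h with ⟨rfl, rfl⟩ | ⟨rfl, rfl⟩
  · rfl
  · exact absurd hab.1 hcd.2

theorem card_cut {V : Type*} [Fintype V] [DecidableEq V] (S : Finset V) :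
    (cut S).card = S.card * Sᶜ.card := by
  rw [cut, Finset.card_image_of_injOn (cut_injOn S), Finset.card_product]

theorem cut_subset_edgeFinset {V : Type*} [Fintype V] [DecidableEq V] (S : Finset V) :
    cut S ⊆ (⊤ : SimpleGraph V).edgeFinset := by
  intro e he
  obtain ⟨⟨a, b⟩, hp, rfl⟩ := Finset.mem_image.1 he
  simp only [Finset.mem_product, Finset.mem_compl] at hp
  simp only [SimpleGraph.mem_edgeFinset, SimpleGraph.mem_edgeSet, SimpleGraph.top_adj]
  rintro rfl
  exact hp.2 hp.1

theorem card_inter_cut {V : Type*} [Fintype V] [DecidableEq V] (E : Finset (Sym2 V))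
    (S : Finset V) :
    ((E ∩ cut S).card : ℝ) = ∑ i ∈ S, ∑ j ∈ Sᶜ, if s(i, j) ∈ E then 1 else 0 := by
  rw [← Finset.sum_product', ← Finset.sum_image (g := fun p : V × V => s(p.1, p.2))
    (f := fun e => if e ∈ E then (1 : ℝ) else 0) (cut_injOn S), ← Finset.sum_filter,
    Finset.filter_mem_eq_inter, Finset.inter_comm]
  simp [cut]

/-! ### The homogeneous chain and its conductance -/

theorem isNext_iff {n : ℕ} [NeZero n] (i j : Fin n) : IsNext i j ↔ j = i + 1 := by
  rw [IsNext, Fin.ext_iff, Fin.val_add, Fin.val_one', Nat.add_mod_mod]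
  exact eq_comm

theorem sum_moveProb_left {n : ℕ} [NeZero n] (qc ql r d : ℝ) (E : Finset (Sym2 (Fin n)))
    (i : Fin n) : ∑ j, moveProb qc ql r d E i j =
      2 * qc + ql / d * ∑ j, if s(i, j) ∈ E then 1 else 0 := by
  have h : ∀ j, i = j + 1 ↔ j = i - 1 := fun j => by rw [eq_sub_iff_add_eq, eq_comm]
  simp only [moveProb, isNext_iff, Finset.sum_add_distrib, h, Finset.sum_ite_eq',
    Finset.mem_univ, if_true, Finset.mul_sum, mul_ite, mul_one, mul_zero]
  congr 1
  ring

/-- Time reversal flips the drift, so column sums are row sums for -r. -/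
theorem moveProb_comm {n : ℕ} (qc ql r d : ℝ) (E : Finset (Sym2 (Fin n))) (i j : Fin n) :
    moveProb qc ql r d E i j = moveProb qc ql (-r) d E j i := by
  simp only [moveProb, Sym2.eq_swap (a := i)]
  ring_nf

theorem sum_ite_mem_eq_longDegree {n : ℕ} {E : Finset (Sym2 (Fin n))}
    (i : Fin n) : (∑ j, if s(i, j) ∈ E then (1 : ℝ) else 0) = longDegree E i := by
  classical
  rw [← Finset.sum_image (g := fun j => s(i, j)) (f := fun e => if e ∈ E then (1 : ℝ) else 0)
    fun a _ b _ h => Sym2.congr_right.1 h, ← Finset.sum_filter, Finset.sum_const, nsmul_one]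
  congr 2
  ext e
  simp only [Finset.mem_filter, Finset.mem_image, Finset.mem_univ, true_and, Sym2.mem_iff_exists]
  constructor
  · rintro ⟨⟨a, rfl⟩, h⟩
    exact ⟨h, a, rfl⟩
  · rintro ⟨h, a, rfl⟩
    exact ⟨⟨a, rfl⟩, h⟩

theorem moveProb_self {n : ℕ} (hn : 2 ≤ n) (qc ql r d : ℝ) {E : Finset (Sym2 (Fin n))}
    (hE : E ⊆ (⊤ : SimpleGraph (Fin n)).edgeFinset) (i : Fin n) :
    moveProb qc ql r d E i i = 0 := by
  have h1 : ¬ IsNext i i := by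
    intro h
    rw [IsNext] at h
    have := i.isLt
    rcases Nat.lt_or_ge (i.val + 1) n with h' | h'
    · rw [Nat.mod_eq_of_lt h'] at h; omega
    · have : i.val + 1 = n := by omega
      rw [this, Nat.mod_self] at h; omega
  have h2 : s(i, i) ∉ E := fun h => by
    have := hE h
    simp at this
  simp [moveProb, h1, h2]

/-- Total probability of moving out of and into a node are both 2 qc + (ql/d) deg, whatever r is;
the degree bound keeps the holding probability nonnegative. -/
theorem homogeneousChain_mem_doublyStochastic {n : ℕ} (hn : 2 ≤ n) {qc ql r d : ℝ}
    (hql : 0 ≤ ql) (hq : 2 * qc + ql ≤ 1) (hr : |r| ≤ qc) (hd : 0 < d)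
    {E : Finset (Sym2 (Fin n))} (hE : E ⊆ (⊤ : SimpleGraph (Fin n)).edgeFinset)
    (hdeg : ∀ i, (longDegree E i : ℝ) ≤ d) :
    homogeneousChain qc ql r d E ∈ doublyStochastic ℝ (Fin n) := by
  have : NeZero n := ⟨by omega⟩
  have hr' := abs_le.1 hr
  have hself := moveProb_self hn qc ql r d hE
  have hout : ∀ i, ∑ k ∈ Finset.univ.erase i, moveProb qc ql r d E i k =
      2 * qc + ql / d * longDegree E i := by
    intro i
    rw [Finset.sum_erase _ (hself i), sum_moveProb_left, sum_ite_mem_eq_longDegree]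
  have hin : ∀ i, ∑ k ∈ Finset.univ.erase i, moveProb qc ql r d E k i =
      2 * qc + ql / d * longDegree E i := by
    intro i
    rw [Finset.sum_erase (f := fun k => moveProb qc ql r d E k i) _ (hself i)]
    simp_rw [fun k => moveProb_comm qc ql r d E k i]
    rw [sum_moveProb_left, sum_ite_mem_eq_longDegree]
  rw [mem_doublyStochastic_iff_sum]
  refine ⟨fun i j => ?_, fun i => ?_, fun j => ?_⟩
  · rw [homogeneousChain]
    split_ifs
    · rw [hout i]
      have : ql / d * longDegree E i ≤ ql / d * d := by
        gcongr
        exact hdeg i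
      rw [div_mul_cancel₀ _ hd.ne'] at this
      linarith
    · rw [moveProb]
      have : 0 ≤ ql / d := by positivity
      have h1 : 0 ≤ qc + r := by linarith
      have h2 : 0 ≤ qc - r := by linarith
      positivity
  · rw [← Finset.add_sum_erase _ _ (Finset.mem_univ i)]
    have h : ∀ k ∈ Finset.univ.erase i, homogeneousChain qc ql r d E i k =
        moveProb qc ql r d E i k := fun k hk => if_neg (Finset.ne_of_mem_erase hk).symm
    rw [Finset.sum_congr rfl h, homogeneousChain, if_pos rfl]
    ring
  · rw [← Finset.add_sum_erase _ _ (Finset.mem_univ j)]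
    have h : ∀ k ∈ Finset.univ.erase j, homogeneousChain qc ql r d E k j =
        moveProb qc ql r d E k j := fun k hk => if_neg (Finset.ne_of_mem_erase hk)
    rw [Finset.sum_congr rfl h, homogeneousChain, if_pos rfl, hout, hin]
    ring

theorem flow_uniformDist_homogeneousChain {n : ℕ} [NeZero n] (qc ql r d : ℝ)
    (E : Finset (Sym2 (Fin n))) (S : Finset (Fin n)) :
    flow (uniformDist n) (homogeneousChain qc ql r d E) S Sᶜ =
      (n : ℝ)⁻¹ * (2 * qc * (exits S).card + ql / d * (E ∩ cut S).card) := by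
  have h0 : ∀ i ∈ S, ∀ j ∈ Sᶜ, homogeneousChain qc ql r d E i j = moveProb qc ql r d E i j := by
    intro i hi j hj
    refine if_neg ?_
    rintro rfl
    exact Finset.mem_compl.1 hj hi
  have h1 : ∑ i ∈ S, ∑ j ∈ Sᶜ, (if j = i + 1 then qc + r else 0) =
      (exits S).card * (qc + r) := by
    have : exits S = S.filter fun i => i + 1 ∈ Sᶜ := by ext i; simp [exits]
    rw [this, ← nsmul_eq_mul, ← Finset.sum_const, Finset.sum_filter]
    exact Finset.sum_congr rfl fun i _ => by rw [Finset.sum_ite_eq']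
  have h2 : ∑ i ∈ S, ∑ j ∈ Sᶜ, (if i = j + 1 then qc - r else 0) =
      (exits S).card * (qc - r) := by
    have : entries S = Sᶜ.filter fun i => i + 1 ∈ S := by ext i; simp [entries]
    rw [card_exits_eq_card_entries, this, ← nsmul_eq_mul, ← Finset.sum_const, Finset.sum_filter,
      Finset.sum_comm]
    exact Finset.sum_congr rfl fun i _ => by rw [Finset.sum_ite_eq']
  have h3 : ∑ i ∈ S, ∑ j ∈ Sᶜ, moveProb qc ql r d E i j =
      2 * qc * (exits S).card + ql / d * (E ∩ cut S).card := by
    simp only [moveProb, isNext_iff, Finset.sum_add_distrib, h1, h2]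
    rw [card_inter_cut, Finset.mul_sum]
    simp only [Finset.mul_sum, mul_ite, mul_one, mul_zero]
    congr 1
    ring
  rw [flow, ← h3, Finset.mul_sum]
  refine Finset.sum_congr rfl fun i hi => ?_
  rw [Finset.mul_sum]
  exact Finset.sum_congr rfl fun j hj => by rw [h0 i hi j hj, uniformDist]

/-- The quotient whose minimum over `S` is the conductance of the homogeneous chain. -/
theorem flow_div_eq {n : ℕ} [NeZero n] (qc ql r d : ℝ)
    (E : Finset (Sym2 (Fin n))) (S : Finset (Fin n)) :
    flow (uniformDist n) (homogeneousChain qc ql r d E) S Sᶜ /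
        ((∑ i ∈ S, uniformDist n i) * ∑ i ∈ Sᶜ, uniformDist n i) =
      n * (2 * qc * (exits S).card + ql / d * (E ∩ cut S).card) / (S.card * Sᶜ.card) := by
  have hn : (n : ℝ) ≠ 0 := Nat.cast_ne_zero.2 (NeZero.ne n)
  rw [flow_uniformDist_homogeneousChain]
  simp only [uniformDist, Finset.sum_const, nsmul_eq_mul]
  field_simp

/-- Replaces the classical decidability instance in the definition by the ambient one. -/
theorem conductance_eq {V : Type*} [Fintype V] [DecidableEq V] (π : V → ℝ) (P : Matrix V V ℝ) :
    conductance π P = ⨅ S : {S : Finset V // S.Nonempty ∧ S ≠ Finset.univ},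
      flow π P S.1 S.1ᶜ / ((∑ i ∈ S.1, π i) * ∑ i ∈ S.1ᶜ, π i) := by
  rw [conductance]
  congr!

theorem conductance_le {V : Type*} [Fintype V] [DecidableEq V] (π : V → ℝ) (P : Matrix V V ℝ)
    {S : Finset V} (hS : S.Nonempty) (hS' : S ≠ Finset.univ) :
    conductance π P ≤ flow π P S Sᶜ / ((∑ i ∈ S, π i) * ∑ i ∈ Sᶜ, π i) := by
  have h := ciInf_le (Set.finite_range fun S : {S : Finset V // S.Nonempty ∧ S ≠ Finset.univ} =>
    flow π P S.1 S.1ᶜ / ((∑ i ∈ S.1, π i) * ∑ i ∈ S.1ᶜ, π i)).bddBelow ⟨S, hS, hS'⟩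
  rw [conductance_eq]
  exact h

theorem exists_eq_conductance {V : Type*} [Fintype V] [DecidableEq V] [Nontrivial V] (π : V → ℝ)
    (P : Matrix V V ℝ) : ∃ S : Finset V, S.Nonempty ∧ S ≠ Finset.univ ∧
      flow π P S Sᶜ / ((∑ i ∈ S, π i) * ∑ i ∈ Sᶜ, π i) = conductance π P := by
  obtain ⟨a, b, hab⟩ := exists_pair_ne V
  have : Nonempty {S : Finset V // S.Nonempty ∧ S ≠ Finset.univ} :=
    ⟨{a}, by simp, fun h => hab (Finset.mem_singleton.1 (h ▸ Finset.mem_univ b)).symm⟩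
  obtain ⟨S, hS⟩ := exists_eq_ciInf_of_finite
    (f := fun S : {S : Finset V // S.Nonempty ∧ S ≠ Finset.univ} =>
      flow π P S.1 S.1ᶜ / ((∑ i ∈ S.1, π i) * ∑ i ∈ S.1ᶜ, π i))
  refine ⟨S.1, S.2.1, S.2.2, ?_⟩
  rw [conductance_eq]
  exact hS

/-! ### Asymptotically almost sure events and the size of the model -/

/-- Quantifying over arbitrary sets of bad samples keeps decidability instances out of the
hypothesis. -/
theorem aasM2_of_card_filter_not_le {α : ℝ} {A : (n : ℕ) → Finset (Sym2 (Fin n)) → Prop}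
    {f : ℕ → ℝ} (hf : Tendsto f atTop (𝓝 0)) (hne : ∀ᶠ n in atTop, (sampleM2 α n).Nonempty)
    (h : ∀ᶠ n in atTop, ∀ B ⊆ sampleM2 α n, (∀ E ∈ B, ¬ A n E) →
      (B.card : ℝ) ≤ f n * (sampleM2 α n).card) :
    AasM2 α A := by
  classical
  have hlim : Tendsto (fun n => 1 - f n) atTop (𝓝 1) := by simpa using hf.const_sub 1
  refine tendsto_of_tendsto_of_tendsto_of_le_of_le' hlim tendsto_const_nhds ?_ ?_
  · filter_upwards [hne, h] with n hn hB
    have hpos : (0 : ℝ) < (sampleM2 α n).card := by exact_mod_cast hn.card_pos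
    have h1 := hB ((sampleM2 α n).filter fun E => ¬ A n E) (Finset.filter_subset _ _)
      fun E hE => (Finset.mem_filter.1 hE).2
    have h2 := Finset.card_filter_add_card_filter_not (s := sampleM2 α n) (A n)
    have h2' : (((sampleM2 α n).filter (A n)).card : ℝ) +
        ((sampleM2 α n).filter fun E => ¬ A n E).card = (sampleM2 α n).card := by
      exact_mod_cast h2
    rw [probM2, le_div_iff₀ hpos]
    convert (by linarith : (1 - f n) * (sampleM2 α n).card ≤
      (((sampleM2 α n).filter (A n)).card : ℝ))
  · exact Eventually.of_forall fun n => div_le_one_of_le₀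
      (by exact_mod_cast Finset.card_filter_le _ _) (by positivity)

theorem AasM2.mono {α : ℝ} {A B : (n : ℕ) → Finset (Sym2 (Fin n)) → Prop} (hA : AasM2 α A)
    (h : ∀ᶠ n in atTop, ∀ E ∈ sampleM2 α n, A n E → B n E) : AasM2 α B := by
  classical
  refine tendsto_of_tendsto_of_tendsto_of_le_of_le' hA tendsto_const_nhds ?_ ?_
  · filter_upwards [h] with n hn
    refine div_le_div_of_nonneg_right ?_ (by positivity)
    norm_cast
    refine Finset.card_le_card fun E hE => ?_
    rw [Finset.mem_filter] at hE ⊢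
    exact ⟨hE.1, hn E hE.1 hE.2⟩
  · exact Eventually.of_forall fun n => div_le_one_of_le₀
      (by exact_mod_cast Finset.card_filter_le _ _) (by positivity)

theorem AasM2.and {α : ℝ} {A B : (n : ℕ) → Finset (Sym2 (Fin n)) → Prop} (hA : AasM2 α A)
    (hB : AasM2 α B) (hne : ∀ᶠ n in atTop, (sampleM2 α n).Nonempty) :
    AasM2 α fun n E => A n E ∧ B n E := by
  classical
  have hlim : Tendsto (fun n => (1 - probM2 α n (A n)) + (1 - probM2 α n (B n))) atTop (𝓝 0) := by
    simpa using (hA.const_sub 1).add (hB.const_sub 1)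
  refine aasM2_of_card_filter_not_le hlim hne ?_
  filter_upwards [hne] with n hn C hC hnot
  have hpos : (0 : ℝ) < (sampleM2 α n).card := by exact_mod_cast hn.card_pos
  have key : ∀ D : Finset (Sym2 (Fin n)) → Prop,
      (1 - probM2 α n D) * (sampleM2 α n).card = ((sampleM2 α n).filter fun E => ¬ D E).card := by
    intro D
    have h2' : (((sampleM2 α n).filter D).card : ℝ) +
        ((sampleM2 α n).filter fun E => ¬ D E).card = (sampleM2 α n).card := by
      exact_mod_cast Finset.card_filter_add_card_filter_not (s := sampleM2 α n) D
    have h3 : probM2 α n D * (sampleM2 α n).card = ((sampleM2 α n).filter D).card := by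
      rw [probM2, div_mul_cancel₀ _ hpos.ne']
    linarith
  rw [add_mul, key, key]
  norm_cast
  refine (Finset.card_le_card fun E hE => ?_).trans (Finset.card_union_le _ _)
  have := hnot E hE
  simp only [Finset.mem_union, Finset.mem_filter]
  have := hC hE
  tauto

theorem mem_sampleM2 {α : ℝ} {n : ℕ} {E : Finset (Sym2 (Fin n))} : E ∈ sampleM2 α n ↔
    E ⊆ (⊤ : SimpleGraph (Fin n)).edgeFinset ∧ E.card = ⌈(n : ℝ) ^ (2 - α)⌉₊ :=
  Finset.mem_powersetCard

theorem card_edgeFinset_top_fin (n : ℕ) :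
    (⊤ : SimpleGraph (Fin n)).edgeFinset.card = n.choose 2 := by
  have := SimpleGraph.card_edgeFinset_top_eq_card_choose_two (V := Fin n)
  rw [Fintype.card_fin] at this
  rw [← this]

theorem card_sampleM2 (α : ℝ) (n : ℕ) :
    (sampleM2 α n).card = (n.choose 2).choose ⌈(n : ℝ) ^ (2 - α)⌉₊ := by
  rw [sampleM2, Finset.card_powersetCard, card_edgeFinset_top_fin]

theorem eventually_log_le {α : ℝ} (hα2 : α < 2) : ∀ᶠ n : ℕ in atTop, 3 ≤ n ∧ 1 ≤ Real.log n ∧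
    (n : ℝ) ^ (2 - α) ≤ ⌈(n : ℝ) ^ (2 - α)⌉₊ ∧ (⌈(n : ℝ) ^ (2 - α)⌉₊ : ℝ) ≤ 2 * (n : ℝ) ^ (2 - α) ∧
    1 ≤ ⌈(n : ℝ) ^ (2 - α)⌉₊ := by
  have hlog : Tendsto (fun n : ℕ => Real.log n) atTop atTop :=
    Real.tendsto_log_atTop.comp tendsto_natCast_atTop_atTop
  filter_upwards [eventually_ge_atTop 3, hlog.eventually_ge_atTop 1] with n hn hl
  have h1 : (1 : ℝ) ≤ (n : ℝ) ^ (2 - α) :=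
    Real.one_le_rpow (by exact_mod_cast (by omega : 1 ≤ n)) (by linarith)
  refine ⟨hn, hl, Nat.le_ceil _, ?_, Nat.one_le_ceil_iff.2 (by linarith)⟩
  have := Nat.ceil_lt_add_one (zero_le_one.trans h1)
  linarith

theorem sq_div_four_le_choose_two {n : ℕ} (hn : 3 ≤ n) : (n : ℝ) ^ 2 / 4 ≤ (n.choose 2 : ℝ) := by
  rw [Nat.cast_choose_two]
  have : (3 : ℝ) ≤ n := by exact_mod_cast hn
  nlinarith

theorem choose_two_le_sq_div_two (n : ℕ) : (n.choose 2 : ℝ) ≤ (n : ℝ) ^ 2 / 2 := by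
  rw [Nat.cast_choose_two]
  have : (0 : ℝ) ≤ n := by positivity
  nlinarith

theorem eventually_two_mul_sq_le {α : ℝ} (hα : 1 < α) (hα2 : α < 2) :
    ∀ᶠ n : ℕ in atTop, 2 * ⌈(n : ℝ) ^ (2 - α)⌉₊ ^ 2 ≤ n.choose 2 := by
  have hlim : Tendsto (fun n : ℕ => (n : ℝ) ^ (-(2 * (α - 1)))) atTop (𝓝 0) :=
    (tendsto_rpow_neg_atTop (by linarith)).comp tendsto_natCast_atTop_atTop
  -- With m ≤ 2n^(2-α), 2m² is at most 8n² · n^(-2(α-1)), and 8/32 = 1/4 matches the lower bound on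
  -- n choose 2. Here α > 1 is needed.
  filter_upwards [eventually_log_le hα2, hlim.eventually_le_const (by norm_num : (0 : ℝ) < 1 / 32)]
    with n ⟨hn, _, _, hm, _⟩ hs
  have hn0 : (0 : ℝ) < n := by exact_mod_cast (by omega : 0 < n)
  have h1 : ((n : ℝ) ^ (2 - α)) ^ 2 = n ^ 2 * (n : ℝ) ^ (-(2 * (α - 1))) := by
    rw [← Real.rpow_natCast, ← Real.rpow_mul hn0.le, ← Real.rpow_natCast, ← Real.rpow_add hn0]
    congr 1
    push_cast
    ring
  have h2 := sq_div_four_le_choose_two hn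
  have h3 : (⌈(n : ℝ) ^ (2 - α)⌉₊ : ℝ) ^ 2 ≤ (2 * (n : ℝ) ^ (2 - α)) ^ 2 := by gcongr
  rw [mul_pow, h1] at h3
  have h4 : (n : ℝ) ^ 2 * (n : ℝ) ^ (-(2 * (α - 1))) ≤ n ^ 2 * (1 / 32) := by gcongr
  have : (2 * (⌈(n : ℝ) ^ (2 - α)⌉₊ : ℝ) ^ 2) ≤ (n.choose 2 : ℝ) := by linarith
  exact_mod_cast this

theorem eventually_sampleM2_nonempty {α : ℝ} (hα : 1 < α) (hα2 : α < 2) :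
    ∀ᶠ n : ℕ in atTop, (sampleM2 α n).Nonempty := by
  filter_upwards [eventually_two_mul_sq_le hα hα2] with n hn
  rw [← Finset.card_pos, card_sampleM2]
  exact Nat.choose_pos (by nlinarith)

/-- Exponential moments of the number of long range edges in a given set of pairs. -/
theorem eventually_sum_sampleM2_pow_le {α : ℝ} (hα : 1 < α) (hα2 : α < 2) :
    ∀ᶠ n : ℕ in atTop, ∀ B ⊆ (⊤ : SimpleGraph (Fin n)).edgeFinset, ∀ θ : ℝ, 0 ≤ θ →
      ∑ E ∈ sampleM2 α n, θ ^ (E ∩ B).card ≤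
        2 * Real.exp ((θ - 1) * (B.card * ⌈(n : ℝ) ^ (2 - α)⌉₊ / n.choose 2)) *
          (sampleM2 α n).card := by
  filter_upwards [eventually_log_le hα2, eventually_two_mul_sq_le hα hα2]
    with n ⟨hn, _, _, _, hm1⟩ hm B hB θ hθ
  have := sum_powersetCard_pow_card_inter_le hB (m := ⌈(n : ℝ) ^ (2 - α)⌉₊)
    (by rwa [card_edgeFinset_top_fin]) (by rw [card_edgeFinset_top_fin]; nlinarith) hθ
  rwa [card_edgeFinset_top_fin] at this

/-! ### Bounded long range degrees -/

theorem exists_isDegreeBoundM2 {α : ℝ} (hα : 1 < α) (hα2 : α < 2) :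
    ∃ d : ℝ, IsDegreeBoundM2 α d := by
  classical
  -- This choice makes θ^t ≥ n² for θ = n^(α-1), so Markov's inequality survives a union over n
  -- nodes.
  obtain ⟨t, ht⟩ := exists_nat_ge (2 / (α - 1))
  rw [div_le_iff₀ (by linarith)] at ht
  refine ⟨t, aasM2_of_card_filter_not_le (f := fun n : ℕ => 2 * Real.exp 8 * (n : ℝ)⁻¹) ?_
    (eventually_sampleM2_nonempty hα hα2) ?_⟩
  · simpa using (tendsto_inv_atTop_nhds_zero_nat (𝕜 := ℝ)).const_mul (2 * Real.exp 8)
  filter_upwards [eventually_log_le hα2, eventually_sum_sampleM2_pow_le hα hα2]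
    with n ⟨hn, _, _, hm, _⟩ hexp C hC hnot
  have hn0 : (0 : ℝ) < n := by exact_mod_cast (by omega : 0 < n)
  have hn1 : (1 : ℝ) ≤ n := by exact_mod_cast (by omega : 1 ≤ n)
  set θ : ℝ := (n : ℝ) ^ (α - 1) with hθ
  have hθ1 : 1 ≤ θ := Real.one_le_rpow hn1 (by linarith)
  set star : Fin n → Finset (Sym2 (Fin n)) := fun v =>
    (⊤ : SimpleGraph (Fin n)).edgeFinset.filter fun e => v ∈ e with hstar
  have hcard : ∀ v, ((star v).card : ℝ) ≤ n := by
    intro v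
    have : star v ⊆ Finset.univ.image fun j => s(v, j) := by
      intro e he
      obtain ⟨j, rfl⟩ := (Sym2.mem_iff_exists).1 (Finset.mem_filter.1 he).2
      simp
    have := (Finset.card_le_card this).trans Finset.card_image_le
    rw [Finset.card_univ, Fintype.card_fin] at this
    exact_mod_cast this
  have hdeg : ∀ E ∈ C, ∀ v, longDegree E v = (E ∩ star v).card := by
    intro E hE v
    have hEU := (mem_sampleM2.1 (hC hE)).1
    rw [longDegree]
    congr 1
    ext e
    simp only [hstar, Finset.mem_filter, Finset.mem_inter]
    exact ⟨fun h => ⟨h.1, hEU h.1, h.2⟩, fun h => ⟨h.1, h.2.2⟩⟩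
  have h1 : ∀ v, ∑ E ∈ sampleM2 α n, θ ^ (E ∩ star v).card ≤
      2 * Real.exp 8 * (sampleM2 α n).card := by
    intro v
    refine (hexp (star v) (Finset.filter_subset _ _) θ (by linarith)).trans ?_
    have hN := sq_div_four_le_choose_two hn
    have hθn : θ * (n : ℝ) ^ (2 - α) = n := by
      rw [hθ, ← Real.rpow_add hn0]
      norm_num
    -- The mean degree has order n^(1-α), so tilting by θ = n^(α-1) keeps the exponent bounded.
    have : (θ - 1) * ((star v).card * ⌈(n : ℝ) ^ (2 - α)⌉₊ / n.choose 2) ≤ 8 := by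
      calc _ ≤ θ * (n * (2 * (n : ℝ) ^ (2 - α)) / (n ^ 2 / 4)) := by
            gcongr
            · linarith
            · exact_mod_cast hcard v
        _ = 8 * (θ * (n : ℝ) ^ (2 - α)) / n := by field_simp; ring
        _ = 8 := by rw [hθn]; field_simp
    gcongr
  have h2 : C.card * θ ^ t ≤ n * (2 * Real.exp 8 * (sampleM2 α n).card) := by
    calc C.card * θ ^ t = ∑ E ∈ C, θ ^ t := by rw [Finset.sum_const, nsmul_eq_mul]
      _ ≤ ∑ E ∈ C, ∑ v, θ ^ (E ∩ star v).card := by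
          refine Finset.sum_le_sum fun E hE => ?_
          have := hnot E hE
          push Not at this
          obtain ⟨v, hv⟩ := this
          rw [hdeg E hE v] at hv
          refine le_trans ?_ (Finset.single_le_sum (f := fun v => θ ^ (E ∩ star v).card)
            (fun v _ => by positivity) (Finset.mem_univ v))
          exact pow_le_pow_right₀ hθ1 (by exact_mod_cast hv.le)
      _ ≤ ∑ E ∈ sampleM2 α n, ∑ v, θ ^ (E ∩ star v).card :=
          Finset.sum_le_sum_of_subset_of_nonneg hC fun _ _ _ => by positivity
      _ ≤ ∑ v : Fin n, 2 * Real.exp 8 * (sampleM2 α n).card := by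
          rw [Finset.sum_comm]
          exact Finset.sum_le_sum fun v _ => h1 v
      _ = _ := by simp
  have h3 : (n : ℝ) ^ 2 ≤ θ ^ t := by
    rw [hθ, ← Real.rpow_natCast (_ ^ _) t, ← Real.rpow_mul hn0.le, ← Real.rpow_natCast (n : ℝ) 2]
    apply Real.rpow_le_rpow_of_exponent_le hn1
    push_cast
    linarith
  have h4 : (C.card : ℝ) * n ^ 2 ≤ n * (2 * Real.exp 8 * (sampleM2 α n).card) :=
    le_trans (by gcongr) h2
  have h5 : 2 * Real.exp 8 * (n : ℝ)⁻¹ * (sampleM2 α n).card =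
      n * (2 * Real.exp 8 * (sampleM2 α n).card) / n ^ 2 := by field_simp
  rw [h5, le_div_iff₀ (by positivity)]
  exact h4

/-! ### Lower bound: every set has a large boundary -/

/-- Asymptotically almost surely every set of nodes has a large boundary. -/
theorem aasM2_card_exits_add_card_inter_cut {α : ℝ} (hα : 1 < α) (hα2 : α < 2) :
    AasM2 α fun n E => ∀ _ : NeZero n, ∀ S : Finset (Fin n), S.Nonempty → S ≠ Finset.univ →
      (S.card * Sᶜ.card) * (n : ℝ) ^ (-α) / (6 * Real.log n) ≤
        (exits S).card + (E ∩ cut S).card := by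
  classical
  refine aasM2_of_card_filter_not_le (f := fun n : ℕ => 4 * Real.exp 2 * (n : ℝ)⁻¹) ?_
    (eventually_sampleM2_nonempty hα hα2) ?_
  · simpa using (tendsto_inv_atTop_nhds_zero_nat (𝕜 := ℝ)).const_mul (4 * Real.exp 2)
  filter_upwards [eventually_log_le hα2, eventually_sum_sampleM2_pow_le hα hα2]
    with n ⟨hn, hlog, hm, _, _⟩ hexp C hC hnot
  have hn0 : (0 : ℝ) < n := by exact_mod_cast (by omega : 0 < n)
  have hn1 : (1 : ℝ) ≤ n := by exact_mod_cast (by omega : 1 ≤ n)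
  have : NeZero n := ⟨by omega⟩
  set μ : Finset (Fin n) → ℝ := fun S => (S.card * Sᶜ.card) * (n : ℝ) ^ (-α) with hμ
  have hμ0 : ∀ S, 0 ≤ μ S := fun S => by positivity
  -- Only these sets can fail; for all others the exits alone suffice.
  set G : Finset (Finset (Fin n)) := Finset.univ.filter fun S => S.Nonempty ∧ S ≠ Finset.univ ∧
    6 * (exits S).card * Real.log n < μ S with hG
  have h1 : ∀ S ∈ G, ∑ E ∈ sampleM2 α n, Real.exp (μ S / 6) * (1 / 2 : ℝ) ^ (E ∩ cut S).card ≤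
      2 * (n : ℝ)⁻¹ * ((n : ℝ) ^ 2)⁻¹ ^ ((exits S).card + (entries S).card) *
        (sampleM2 α n).card := by
    intro S hS
    obtain ⟨-, hS1, hS2, hS3⟩ := Finset.mem_filter.1 hS
    have hk := (exits_nonempty hS1 hS2).card_pos
    have hμm : 2 * μ S ≤ (cut S).card * ⌈(n : ℝ) ^ (2 - α)⌉₊ / n.choose 2 := by
      have hN := choose_two_le_sq_div_two n
      have hN0 : (0 : ℝ) < n.choose 2 := by exact_mod_cast Nat.choose_pos (by omega)
      calc 2 * μ S = (cut S).card * (n : ℝ) ^ (2 - α) / (n ^ 2 / 2) := by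
            rw [card_cut, hμ, show (2 - α) = 2 + -α by ring, Real.rpow_add hn0,
              Real.rpow_two]
            push_cast
            field_simp
        _ ≤ _ := by gcongr
    have h2 := hexp (cut S) (cut_subset_edgeFinset S) (1 / 2) (by norm_num)
    have h3 : Real.exp ((1 / 2 - 1) * ((cut S).card * ⌈(n : ℝ) ^ (2 - α)⌉₊ / n.choose 2)) ≤
        Real.exp (-μ S) := Real.exp_le_exp.2 (by linarith)
    have h4 : Real.exp (μ S / 6) * Real.exp (-μ S) ≤
        (n : ℝ)⁻¹ * ((n : ℝ) ^ 2)⁻¹ ^ ((exits S).card + (entries S).card) := by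
      rw [← card_exits_eq_card_entries, ← Real.exp_add]
      calc Real.exp (μ S / 6 + -μ S) ≤ Real.exp (-((5 * (exits S).card : ℕ) * Real.log n)) := by
            apply Real.exp_le_exp.2
            push_cast
            linarith
        _ = ((n : ℝ) ^ (5 * (exits S).card))⁻¹ := by
            rw [Real.exp_neg, Real.exp_nat_mul, Real.exp_log hn0]
        -- As k ≥ 1, 5k ≥ 1 + 4k: n^(-4k) pays for the number of sets, and n^(-1) remains as the
        -- failure probability.
        _ ≤ ((n : ℝ) ^ (1 + 2 * ((exits S).card + (exits S).card)))⁻¹ := by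
            gcongr 1
            exact pow_le_pow_right₀ hn1 (by omega)
        _ = _ := by rw [pow_add, pow_mul, mul_inv, pow_one, inv_pow]
    rw [← Finset.mul_sum]
    calc _ ≤ Real.exp (μ S / 6) * (2 * Real.exp (-μ S) * (sampleM2 α n).card) := by
          refine mul_le_mul_of_nonneg_left (h2.trans ?_) (Real.exp_pos _).le
          gcongr
      _ = 2 * (Real.exp (μ S / 6) * Real.exp (-μ S)) * (sampleM2 α n).card := by ring
      _ ≤ 2 * ((n : ℝ)⁻¹ * ((n : ℝ) ^ 2)⁻¹ ^ ((exits S).card + (entries S).card)) *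
          (sampleM2 α n).card := by gcongr
      _ = _ := by ring
  calc (C.card : ℝ) = ∑ E ∈ C, 1 := by simp
    _ ≤ ∑ E ∈ C, ∑ S ∈ G, Real.exp (μ S / 6) * (1 / 2 : ℝ) ^ (E ∩ cut S).card := by
        refine Finset.sum_le_sum fun E hE => ?_
        have := hnot E hE
        push Not at this
        obtain ⟨_, S, hS1, hS2, hS3⟩ := this
        rw [lt_div_iff₀ (by linarith)] at hS3
        have hS4 : ((exits S).card + (E ∩ cut S).card : ℝ) * (6 * Real.log n) < μ S := by
          convert hS3
        have he0 : (0 : ℝ) ≤ (E ∩ cut S).card := by positivity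
        have hk0 : (0 : ℝ) ≤ (exits S).card := by positivity
        have hSG : S ∈ G := Finset.mem_filter.2 ⟨Finset.mem_univ _, hS1, hS2, by nlinarith⟩
        refine le_trans ?_ (Finset.single_le_sum
          (f := fun S => Real.exp (μ S / 6) * (1 / 2 : ℝ) ^ (E ∩ cut S).card)
          (fun S _ => by positivity) hSG)
        have hhalf : Real.exp (-1) ≤ 1 / 2 := by
          rw [Real.exp_neg, one_div]
          gcongr
          linarith [Real.add_one_le_exp (1 : ℝ)]
        -- Failure gives e < μ/6 because log n ≥ 1, so the tilted weight of this S is at least 1.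
        calc (1 : ℝ) ≤ Real.exp (μ S / 6 + -(E ∩ cut S).card) := by
              apply Real.one_le_exp
              nlinarith
          _ = Real.exp (μ S / 6) * Real.exp (-1) ^ (E ∩ cut S).card := by
              rw [Real.exp_add, ← Real.exp_nat_mul]
              congr 2
              ring
          _ ≤ _ := by gcongr
    _ ≤ ∑ E ∈ sampleM2 α n, ∑ S ∈ G, Real.exp (μ S / 6) * (1 / 2 : ℝ) ^ (E ∩ cut S).card :=
        Finset.sum_le_sum_of_subset_of_nonneg hC fun _ _ _ => by positivity
    _ ≤ ∑ S ∈ G, 2 * (n : ℝ)⁻¹ * ((n : ℝ) ^ 2)⁻¹ ^ ((exits S).card + (entries S).card) *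
        (sampleM2 α n).card := by
        rw [Finset.sum_comm]
        exact Finset.sum_le_sum h1
    _ ≤ ∑ S : Finset (Fin n), 2 * (n : ℝ)⁻¹ *
        ((n : ℝ) ^ 2)⁻¹ ^ ((exits S).card + (entries S).card) * (sampleM2 α n).card :=
        Finset.sum_le_sum_of_subset_of_nonneg (Finset.subset_univ _) fun _ _ _ => by positivity
    _ = 2 * (n : ℝ)⁻¹ * (∑ S : Finset (Fin n),
        ((n : ℝ) ^ 2)⁻¹ ^ ((exits S).card + (entries S).card)) * (sampleM2 α n).card := by
        rw [Finset.mul_sum, Finset.sum_mul]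
    _ ≤ 2 * (n : ℝ)⁻¹ * (2 * Real.exp 2) * (sampleM2 α n).card := by
        have h5 := sum_pow_card_exits_add_card_entries_le n (x := ((n : ℝ) ^ 2)⁻¹) (by positivity)
        have h6 : (1 + ((n : ℝ) ^ 2)⁻¹) ^ (2 * n) ≤ Real.exp 2 := by
          calc _ ≤ Real.exp (((n : ℝ) ^ 2)⁻¹) ^ (2 * n) := by
                gcongr
                rw [add_comm]
                exact Real.add_one_le_exp _
            _ = Real.exp (2 * (n : ℝ)⁻¹) := by
                rw [← Real.exp_nat_mul]
                congr 1
                push_cast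
                field_simp
            _ ≤ Real.exp 2 := by
                apply Real.exp_le_exp.2
                have := inv_le_one_of_one_le₀ hn1
                linarith
        gcongr
        linarith
    _ = _ := by ring

/-! ### Upper bound: an arc without long range edges -/

/-- The unordered pairs of distinct elements of `R`. -/
def pairsIn {V : Type*} [DecidableEq V] (R : Finset V) : Finset (Sym2 V) :=
  R.offDiag.image Sym2.mk.uncurry

theorem card_pairsIn {V : Type*} [DecidableEq V] (R : Finset V) :
    (pairsIn R).card = R.card.choose 2 :=
  Sym2.card_image_offDiag R

theorem mk_mem_pairsIn {V : Type*} [DecidableEq V] {R : Finset V} {a b : V} :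
    s(a, b) ∈ pairsIn R ↔ a ∈ R ∧ b ∈ R ∧ a ≠ b := by
  simp only [pairsIn, Finset.mem_image, Finset.mem_offDiag, Prod.exists, Function.uncurry_apply_pair,
    Sym2.eq_iff]
  constructor
  · rintro ⟨c, d, ⟨hc, hd, hcd⟩, ⟨rfl, rfl⟩ | ⟨rfl, rfl⟩⟩
    · exact ⟨hc, hd, hcd⟩
    · exact ⟨hd, hc, hcd.symm⟩
  · exact fun h => ⟨a, b, h, Or.inl ⟨rfl, rfl⟩⟩

theorem pairsIn_inter {V : Type*} [DecidableEq V] (R R' : Finset V) :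
    pairsIn R ∩ pairsIn R' = pairsIn (R ∩ R') := by
  ext e
  induction e with
  | _ a b => simp only [Finset.mem_inter, mk_mem_pairsIn]; tauto

theorem pairsIn_subset_edgeFinset {n : ℕ} (R : Finset (Fin n)) :
    pairsIn R ⊆ (⊤ : SimpleGraph (Fin n)).edgeFinset := by
  intro e
  induction e with
  | _ a b =>
    intro h
    simpa using (mk_mem_pairsIn.1 h).2.2

/-- The arc of the nodes `L * j, …, L * (j + 1) - 1`. -/
def arc (n L j : ℕ) : Finset (Fin n) :=
  Finset.univ.filter fun i => L * j ≤ i.val ∧ i.val < L * (j + 1)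

theorem card_arc {n L j : ℕ} (h : L * (j + 1) ≤ n) : (arc n L j).card = L := by
  rw [← Finset.card_map Fin.valEmbedding]
  have : (arc n L j).map Fin.valEmbedding = Finset.Ico (L * j) (L * (j + 1)) := by
    ext i
    simp only [arc, Finset.mem_map, Finset.mem_filter, Finset.mem_univ, true_and,
      Fin.valEmbedding_apply, Finset.mem_Ico]
    constructor
    · rintro ⟨a, ha, rfl⟩
      exact ha
    · exact fun hi => ⟨⟨i, by omega⟩, hi, rfl⟩
  rw [this, Nat.card_Ico, mul_add, mul_one, Nat.add_sub_cancel_left]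

theorem disjoint_arc (n L : ℕ) {i j : ℕ} (hij : i ≠ j) : Disjoint (arc n L i) (arc n L j) := by
  wlog h : i < j generalizing i j
  · exact (this hij.symm (by omega)).symm
  rw [Finset.disjoint_left]
  intro a ha hb
  simp only [arc, Finset.mem_filter, Finset.mem_univ, true_and] at ha hb
  have : L * (i + 1) ≤ L * j := Nat.mul_le_mul_left L h
  omega

theorem card_exits_arc_le_one {n L j : ℕ} [NeZero n] : (exits (arc n L j)).card ≤ 1 := by
  rw [Finset.card_le_one]
  -- The second case is the wrap-around at node n - 1, for an arc truncated by the end of the range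
  -- or ending there.
  have key : ∀ a ∈ exits (arc n L j), a.val + 1 = L * (j + 1) ∨ a.val + 1 = n := by
    intro a ha
    simp only [exits, arc, Finset.mem_filter, Finset.mem_univ, true_and, Fin.val_add,
      Fin.val_one', Nat.add_mod_mod] at ha
    have := a.isLt
    rcases Nat.lt_or_ge (a.val + 1) n with h | h
    · rw [Nat.mod_eq_of_lt h] at ha
      omega
    · omega
  have hlt : ∀ a ∈ exits (arc n L j), a.val < L * (j + 1) := by
    intro a ha
    simp only [exits, arc, Finset.mem_filter] at ha
    exact ha.2.1.2.2
  intro a ha b hb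
  have := key a ha
  have := key b hb
  have := hlt a ha
  have := hlt b hb
  have := a.isLt
  have := b.isLt
  apply Fin.ext
  omega

theorem inter_cut_eq_empty {V : Type*} [Fintype V] [DecidableEq V] {E : Finset (Sym2 V)}
    {S : Finset V} (h : E ⊆ pairsIn Sᶜ) : E ∩ cut S = ∅ := by
  ext e
  induction e with
  | _ a b =>
    simp only [Finset.mem_inter, Finset.notMem_empty, iff_false, not_and]
    intro he hc
    have h1 := mk_mem_pairsIn.1 (h he)
    obtain ⟨⟨c, d⟩, hcd, heq⟩ := Finset.mem_image.1 hc
    simp only [Finset.mem_product, Finset.mem_compl] at hcd h1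
    rcases Sym2.eq_iff.1 heq with ⟨rfl, rfl⟩ | ⟨rfl, rfl⟩
    · exact h1.1 hcd.1
    · exact h1.2.1 hcd.1

/-- These are the hypotheses of `choose_mul_choose_le_sq` for the numbers of pairs avoiding no arc,
one arc and two arcs. -/
theorem choose_two_mul_choose_two_le {n L : ℕ} (h : 2 * L ≤ n) :
    n.choose 2 * (n - 2 * L).choose 2 ≤ (n - L).choose 2 ^ 2 ∧
      2 * (n - L).choose 2 ≤ n.choose 2 + (n - 2 * L).choose 2 := by
  obtain ⟨x, rfl⟩ := Nat.exists_eq_add_of_le h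
  rw [show 2 * L + x - 2 * L = x by omega, show 2 * L + x - L = x + L by omega]
  constructor
  · rcases Nat.eq_zero_or_pos x with rfl | hx
    · simp
    · have hx' : (1 : ℝ) ≤ x := by exact_mod_cast hx
      have hL : (0 : ℝ) ≤ L := by positivity
      have : (((2 * L + x).choose 2 : ℕ) : ℝ) * (x.choose 2 : ℕ) ≤ ((x + L).choose 2 : ℕ) ^ 2 := by
        simp only [Nat.cast_choose_two]
        push_cast
        have h1 : (2 * L + x : ℝ) * x ≤ (x + L) ^ 2 := by nlinarith
        have h2 : (2 * L + x - 1 : ℝ) * (x - 1) ≤ (x + L - 1) ^ 2 := by nlinarith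
        have h3 := mul_le_mul h1 h2 (mul_nonneg (by linarith) (by linarith)) (by positivity)
        linarith
      exact_mod_cast this
  · have : (2 * ((x + L).choose 2 : ℕ) : ℝ) ≤ ((2 * L + x).choose 2 : ℕ) + (x.choose 2 : ℕ) := by
      simp only [Nat.cast_choose_two]
      push_cast
      nlinarith [sq_nonneg (L : ℝ)]
    exact_mod_cast this

/-- Few samples have a long range edge at each of the first `K` disjoint arcs of length `L`. -/
theorem card_forall_arc_mul_le {α : ℝ} {n L K : ℕ} (hK : L * K ≤ n)
    {C : Finset (Finset (Sym2 (Fin n)))} (hC : C ⊆ sampleM2 α n)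
    (hnot : ∀ E ∈ C, ∀ j < K, ¬ E ⊆ pairsIn (arc n L j)ᶜ) :
    C.card * (K * ((n - L).choose 2).choose ⌈(n : ℝ) ^ (2 - α)⌉₊) ≤ (sampleM2 α n).card ^ 2 := by
  classical
  set m := ⌈(n : ℝ) ^ (2 - α)⌉₊ with hm
  have hcard : ∀ j < K, (arc n L j).card = L := fun j hj =>
    card_arc ((Nat.mul_le_mul_left L hj).trans hK)
  have h1 := card_filter_forall_notMem_mul_le (sampleM2 α n) (Finset.range K)
    (fun j => (pairsIn (arc n L j)ᶜ).powersetCard m)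
    (fun j _ => Finset.powersetCard_mono (pairsIn_subset_edgeFinset _))
    (((n - L).choose 2).choose m)
    (fun j hj => by
      rw [Finset.card_powersetCard, card_pairsIn, Finset.card_compl, Fintype.card_fin,
        hcard j (Finset.mem_range.1 hj)])
    (fun i hi j hj hij => by
      rw [Finset.mem_range] at hi hj
      have hinter : (pairsIn (arc n L i)ᶜ).powersetCard m ∩ (pairsIn (arc n L j)ᶜ).powersetCard m =
          (pairsIn ((arc n L i)ᶜ ∩ (arc n L j)ᶜ)).powersetCard m := by
        ext E
        simp only [Finset.mem_inter, Finset.mem_powersetCard, ← pairsIn_inter,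
          Finset.subset_inter_iff]
        tauto
      have hcompl : ((arc n L i)ᶜ ∩ (arc n L j)ᶜ).card = n - 2 * L := by
        rw [← Finset.compl_union, Finset.card_compl, Fintype.card_fin,
          Finset.card_union_of_disjoint (disjoint_arc n L hij), hcard i hi, hcard j hj, two_mul]
      have hK2 : 2 ≤ K := by omega
      have h2 := choose_two_mul_choose_two_le
        (show 2 * L ≤ n by nlinarith)
      rw [hinter, Finset.card_powersetCard, card_pairsIn, hcompl, card_sampleM2, mul_comm]
      exact choose_mul_choose_le_sq h2.1 h2.2 m)
  rw [Finset.card_range] at h1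
  refine le_trans (Nat.mul_le_mul_right _ (Finset.card_le_card fun E hE => ?_)) h1
  refine Finset.mem_filter.2 ⟨hC hE, fun j hj h => ?_⟩
  exact hnot E hE j (Finset.mem_range.1 hj) (Finset.mem_powersetCard.1 h).1

theorem exp_neg_two_mul_le_one_sub {x : ℝ} (hx : 0 ≤ x) (hx2 : x ≤ 1 / 2) :
    Real.exp (-(2 * x)) ≤ 1 - x := by
  have h := Real.add_one_le_exp (2 * x)
  rw [Real.exp_neg, inv_le_comm₀ (Real.exp_pos _) (by linarith)]
  refine le_trans ?_ h
  rw [inv_le_iff_one_le_mul₀ (by linarith)]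
  nlinarith

/-- The probability that a given arc of length `L` has no long range edge is not too small. -/
theorem exp_mul_choose_le {n L m : ℕ} (hn : 3 ≤ n) (hL : 1 ≤ L) (hLn : 16 * L ≤ n)
    (hm : 2 * m ^ 2 ≤ n.choose 2) :
    Real.exp (-(16 * L * m / n)) * ((n.choose 2).choose m : ℝ) ≤
      (((n - L).choose 2).choose m : ℝ) := by
  have hn0 : (0 : ℝ) < n := by exact_mod_cast (by omega : 0 < n)
  have hL' : (1 : ℝ) ≤ L := by exact_mod_cast hL
  have hLn' : (16 : ℝ) * L ≤ n := by exact_mod_cast hLn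
  have hN4 := sq_div_four_le_choose_two hn
  have hN2 := choose_two_le_sq_div_two n
  have hm' : (2 : ℝ) * m ^ 2 ≤ n.choose 2 := by exact_mod_cast hm
  have hmn : (m : ℝ) ≤ n := by
    by_contra h
    push Not at h
    nlinarith
  set N : ℝ := ((n.choose 2 : ℕ) : ℝ) with hN
  set N' : ℝ := (((n - L).choose 2 : ℕ) : ℝ) with hN'
  have hNpos : 0 < N := lt_of_lt_of_le (by positivity) hN4
  have hdiff : N - N' ≤ L * n := by
    rw [hN, hN', Nat.cast_choose_two, Nat.cast_choose_two, Nat.cast_sub (by omega)]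
    nlinarith
  -- Both N - N' and m are at most L n, and N ≥ n²/4.
  have hx : (N - N' + m) / N ≤ 8 * L / n := by
    rw [div_le_div_iff₀ hNpos hn0]
    have h1 : (N - N' + m) * n ≤ (L * n + L * n) * n := by
      gcongr
      nlinarith
    nlinarith
  have h8 : 8 * (L : ℝ) / n ≤ 1 / 2 := by
    rw [div_le_iff₀ hn0]; linarith
  have hlow : Real.exp (-(16 * L / n)) * N ≤ N' - m := by
    calc Real.exp (-(16 * L / n)) * N = Real.exp (-(2 * (8 * L / n))) * N := by
          congr 3; ring
      _ ≤ (1 - 8 * L / n) * N := by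
          gcongr
          exact exp_neg_two_mul_le_one_sub (by positivity) h8
      _ ≤ (1 - (N - N' + m) / N) * N := by gcongr
      _ = N' - m := by field_simp; ring
  have hpos : 0 < N' - m := lt_of_lt_of_le (by positivity) hlow
  have hmN' : m ≤ (n - L).choose 2 := by
    exact Nat.cast_le.1 (show (m : ℝ) ≤ N' by linarith)
  have hd1 : (N' - m) ^ m ≤ m.factorial * (((n - L).choose 2).choose m : ℝ) := by
    have h := Nat.pow_sub_le_descFactorial ((n - L).choose 2) m
    rw [Nat.descFactorial_eq_factorial_mul_choose] at h
    calc (N' - m) ^ m = (((n - L).choose 2 - m : ℕ) : ℝ) ^ m := by rw [Nat.cast_sub hmN']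
      _ ≤ (((n - L).choose 2 + 1 - m : ℕ) : ℝ) ^ m := by
          gcongr; omega
      _ ≤ _ := by exact_mod_cast h
  have hd2 : m.factorial * ((n.choose 2).choose m : ℝ) ≤ N ^ m := by
    have h := Nat.descFactorial_le_pow (n.choose 2) m
    rw [Nat.descFactorial_eq_factorial_mul_choose] at h
    rw [hN]
    exact_mod_cast h
  have hf : (0 : ℝ) < m.factorial := by positivity
  refine le_of_mul_le_mul_left ?_ hf
  calc m.factorial * (Real.exp (-(16 * L * m / n)) * ((n.choose 2).choose m : ℝ))
      = Real.exp (-(16 * L * m / n)) * (m.factorial * ((n.choose 2).choose m : ℝ)) := by ring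
    _ ≤ Real.exp (-(16 * L * m / n)) * N ^ m := by gcongr
    _ = (Real.exp (-(16 * L / n)) * N) ^ m := by
        rw [mul_pow, ← Real.exp_nat_mul]
        congr 2
        ring
    _ ≤ (N' - m) ^ m := by gcongr
    _ ≤ _ := hd1

/-- Asymptotically almost surely there is a long arc without long range edges. -/
theorem aasM2_exists_arc {α c : ℝ} (hα : 1 < α) (hα2 : α < 2) (hc : 0 < c)
    (hc2 : 64 * c ≤ 2 - α) :
    AasM2 α fun n E => ∀ _ : NeZero n, ∃ S : Finset (Fin n), (exits S).card ≤ 1 ∧ E ∩ cut S = ∅ ∧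
      c / 2 * ((n : ℝ) ^ (α - 1) * Real.log n) ≤ S.card ∧ S.Nonempty ∧ 2 * S.card ≤ n := by
  have hlogo : ∀ s : ℝ, 0 < s → Tendsto (fun n : ℕ => Real.log n / (n : ℝ) ^ s) atTop (𝓝 0) :=
    fun s hs => (isLittleO_log_rpow_atTop hs).tendsto_div_nhds_zero.comp
      tendsto_natCast_atTop_atTop
  have hlen : Tendsto (fun n : ℕ => c * ((n : ℝ) ^ (α - 1) * Real.log n)) atTop atTop :=
    Tendsto.const_mul_atTop hc (((tendsto_rpow_atTop (by linarith)).comp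
      tendsto_natCast_atTop_atTop).atTop_mul_atTop₀
        (Real.tendsto_log_atTop.comp tendsto_natCast_atTop_atTop))
  have hshort : Tendsto (fun n : ℕ => c * (Real.log n / (n : ℝ) ^ (2 - α))) atTop (𝓝 0) := by
    simpa using (hlogo (2 - α) (by linarith)).const_mul c
  refine aasM2_of_card_filter_not_le
    (f := fun n : ℕ => 2 * c * (Real.log n / (n : ℝ) ^ ((2 - α) / 2))) ?_
    (eventually_sampleM2_nonempty hα hα2) ?_
  · simpa using (hlogo ((2 - α) / 2) (by linarith)).const_mul (2 * c)
  filter_upwards [eventually_log_le hα2, eventually_two_mul_sq_le hα hα2,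
    eventually_sampleM2_nonempty hα hα2, hlen.eventually_ge_atTop 1,
    hshort.eventually_le_const (by norm_num : (0 : ℝ) < 1 / 16)]
    with n ⟨hn, hlog, _, hm, _⟩ hm2 hne h1 h16 C hC hnot
  have hn0 : (0 : ℝ) < n := by exact_mod_cast (by omega : 0 < n)
  have : NeZero n := ⟨by omega⟩
  set ℓ : ℝ := c * ((n : ℝ) ^ (α - 1) * Real.log n) with hℓ
  set L : ℕ := ⌊ℓ⌋₊ with hL
  set m : ℕ := ⌈(n : ℝ) ^ (2 - α)⌉₊ with hmdef
  have hL1 : 1 ≤ L := Nat.one_le_floor_iff _ |>.2 h1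
  have hLle : (L : ℝ) ≤ ℓ := Nat.floor_le (by linarith)
  have hLge : ℓ / 2 ≤ L := by
    have := Nat.lt_floor_add_one ℓ
    have : (1 : ℝ) ≤ L := by exact_mod_cast hL1
    linarith
  have hL0 : (0 : ℝ) < L := by exact_mod_cast hL1
  have hℓn : 16 * ℓ ≤ n := by
    have : ℓ = c * (Real.log n / (n : ℝ) ^ (2 - α)) * n := by
      rw [hℓ, show α - 1 = 1 - (2 - α) by ring, Real.rpow_sub hn0, Real.rpow_one]
      ring
    rw [this]
    nlinarith
  have hLn : 16 * L ≤ n := by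
    have : (16 : ℝ) * L ≤ n := by linarith
    exact_mod_cast this
  set K : ℕ := n / L with hK
  have hLK : L * K ≤ n := Nat.mul_div_le n L
  have hKge : n / (2 * ℓ) ≤ (K : ℝ) := by
    have h2 : (n : ℝ) / L < K + 1 := by
      rw [div_lt_iff₀ hL0]
      exact_mod_cast (Nat.lt_div_mul_add hL1 |>.trans_le (by rw [hK]; ring_nf; rfl))
    have h3 : (2 : ℝ) ≤ n / L := by
      rw [le_div_iff₀ hL0]
      linarith
    -- Since n/L ≥ 2, rounding down to K loses at most a factor 2.
    have h4 : n / (2 * ℓ) ≤ n / L / 2 := by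
      rw [div_div]
      exact div_le_div_of_nonneg_left hn0.le (by positivity) (by linarith)
    linarith
  have harc := card_forall_arc_mul_le hLK hC (fun E hE j hj hsub => hnot E hE fun _ => by
    have hca : (arc n L j).card = L := card_arc ((Nat.mul_le_mul_left L hj).trans hLK)
    refine ⟨arc n L j, ?_, ?_, ?_, ?_, ?_⟩
    · convert card_exits_arc_le_one (n := n) (L := L) (j := j)
    · exact inter_cut_eq_empty hsub
    · rw [hca]
      refine le_trans (le_of_eq ?_) hLge
      rw [hℓ]
      ring
    · rw [← Finset.card_pos, hca]
      exact hL1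
    · rw [hca]
      omega)
  rw [← hmdef] at harc
  have hp := exp_mul_choose_le hn hL1 hLn hm2
  rw [← card_sampleM2 α n] at hp
  set T : ℝ := ((sampleM2 α n).card : ℝ) with hT
  have hT0 : 0 < T := by
    rw [hT]
    exact_mod_cast hne.card_pos
  -- The exponent is at most 32 c log n, and 64c ≤ 2 - α makes this at most half the exponent 2 - α
  -- in the number of arcs.
  have hexp : (n : ℝ) ^ (-((2 - α) / 2)) ≤ Real.exp (-(16 * L * m / n)) := by
    rw [Real.rpow_def_of_pos hn0]
    apply Real.exp_le_exp.2
    have h5 : 16 * L * m / n ≤ 16 * ℓ * (2 * (n : ℝ) ^ (2 - α)) / n := by gcongr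
    have h6 : 16 * ℓ * (2 * (n : ℝ) ^ (2 - α)) / n = 32 * c * Real.log n := by
      have : (n : ℝ) ^ (α - 1) * (n : ℝ) ^ (2 - α) = n := by
        rw [← Real.rpow_add hn0]
        norm_num
      rw [hℓ, div_eq_iff hn0.ne']
      linear_combination 32 * c * Real.log n * this
    nlinarith
  have harc' : (C.card : ℝ) * (K * (((n - L).choose 2).choose m : ℝ)) ≤ T ^ 2 := by
    rw [hT]
    exact_mod_cast harc
  have h7 : (C.card : ℝ) * (n / (2 * ℓ) * ((n : ℝ) ^ (-((2 - α) / 2)) * T)) ≤ T ^ 2 := by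
    refine le_trans ?_ harc'
    gcongr
    exact le_trans (by gcongr) hp
  have h8 : (C.card : ℝ) * (n / (2 * ℓ) * (n : ℝ) ^ (-((2 - α) / 2))) ≤ T := by
    refine le_of_mul_le_mul_right ?_ hT0
    linarith
  -- The error function is the reciprocal of the lower bound for the expected number of isolated
  -- arcs, as Chebyshev gives.
  have h9 : (n : ℝ) / (2 * ℓ) * (n : ℝ) ^ (-((2 - α) / 2)) *
      (2 * c * (Real.log n / (n : ℝ) ^ ((2 - α) / 2))) = 1 := by
    have hlog0 : Real.log n ≠ 0 := by linarith
    have e1 : (n : ℝ) ^ (α - 1) = n * ((n : ℝ) ^ (-((2 - α) / 2))) ^ 2 := by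
      rw [← Real.rpow_natCast (_ ^ _) 2, ← Real.rpow_mul hn0.le]
      nth_rewrite 2 [← Real.rpow_one (n : ℝ)]
      rw [← Real.rpow_add hn0]
      congr 1
      push_cast
      ring
    have e2 : (n : ℝ) ^ ((2 - α) / 2) = ((n : ℝ) ^ (-((2 - α) / 2)))⁻¹ := by
      rw [← Real.rpow_neg hn0.le, neg_neg]
    have e3 : (n : ℝ) ^ (-((2 - α) / 2)) ≠ 0 := (Real.rpow_pos_of_pos hn0 _).ne'
    rw [hℓ, e1, e2]
    field_simp
  have h10 : 0 ≤ 2 * c * (Real.log n / (n : ℝ) ^ ((2 - α) / 2)) := by positivity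
  calc (C.card : ℝ) = C.card * (n / (2 * ℓ) * (n : ℝ) ^ (-((2 - α) / 2))) *
        (2 * c * (Real.log n / (n : ℝ) ^ ((2 - α) / 2))) := by
        rw [mul_assoc, h9, mul_one]
    _ ≤ T * (2 * c * (Real.log n / (n : ℝ) ^ ((2 - α) / 2))) := by gcongr
    _ = _ := by ring

/-! ### From boundaries to conductance -/

/-- With q = min(2 qc, ql) and d ≥ 1, q/d is below both coefficients 2 qc and ql/d, so k + e
controls the flow. The 12 is twice the 6 from the boundary estimate, for strictness. -/
theorem lt_conductance_homogeneousChain {n : ℕ} [NeZero n] (hn : 3 ≤ n) {qc ql r d α : ℝ}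
    (hqc : 0 < qc) (hql : 0 < ql) (hd : 1 ≤ d) (hlog : 1 ≤ Real.log n)
    {E : Finset (Sym2 (Fin n))}
    (hE : ∀ S : Finset (Fin n), S.Nonempty → S ≠ Finset.univ →
      (S.card * Sᶜ.card) * (n : ℝ) ^ (-α) / (6 * Real.log n) ≤
        (exits S).card + (E ∩ cut S).card) :
    min (2 * qc) ql / 12 * d⁻¹ * ((n : ℝ) ^ (1 - α) / Real.log n) <
      conductance (uniformDist n) (homogeneousChain qc ql r d E) := by
  have : Nontrivial (Fin n) := Fin.nontrivial_iff_two_le.2 (by omega)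
  obtain ⟨S, hS, hS', h⟩ := exists_eq_conductance (uniformDist n) (homogeneousChain qc ql r d E)
  rw [← h, flow_div_eq]
  have hn0 : (0 : ℝ) < n := by exact_mod_cast (by omega : 0 < n)
  have hS0 : (0 : ℝ) < S.card := by exact_mod_cast hS.card_pos
  have hS1 : (0 : ℝ) < Sᶜ.card := by
    exact_mod_cast Finset.card_pos.2 (Finset.nonempty_iff_ne_empty.2 (by simpa using hS'))
  set q := min (2 * qc) ql with hq
  have hq0 : 0 < q := lt_min (by linarith) hql
  have hd0 : 0 < d := by linarith
  have hqd : q / d ≤ 2 * qc := (div_le_self hq0.le hd).trans (min_le_left _ _)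
  have hqd' : q / d ≤ ql / d := by
    gcongr
    exact min_le_right _ _
  have h1 := hE S hS hS'
  rw [lt_div_iff₀ (by positivity)]
  have hpow : (n : ℝ) ^ (1 - α) = n * (n : ℝ) ^ (-α) := by
    rw [sub_eq_add_neg, Real.rpow_add hn0, Real.rpow_one]
  calc q / 12 * d⁻¹ * ((n : ℝ) ^ (1 - α) / Real.log n) * (S.card * Sᶜ.card)
      < q / 6 * d⁻¹ * ((n : ℝ) ^ (1 - α) / Real.log n) * (S.card * Sᶜ.card) := by
        gcongr
        norm_num
    _ = n * (q / d * ((S.card * Sᶜ.card) * (n : ℝ) ^ (-α) / (6 * Real.log n))) := by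
        rw [hpow]
        field_simp
    _ ≤ n * (q / d * ((exits S).card + (E ∩ cut S).card)) := by gcongr
    _ = n * (q / d * (exits S).card + q / d * (E ∩ cut S).card) := by ring
    _ ≤ _ := by gcongr

theorem conductance_homogeneousChain_lt {n : ℕ} [NeZero n] (hn : 3 ≤ n) {qc ql r d α c : ℝ}
    (hqc : 0 < qc) (hc : 0 < c) (hlog : 1 ≤ Real.log n) {E : Finset (Sym2 (Fin n))}
    {S : Finset (Fin n)} (h1 : (exits S).card ≤ 1) (h2 : E ∩ cut S = ∅)
    (h3 : c / 2 * ((n : ℝ) ^ (α - 1) * Real.log n) ≤ S.card) (h4 : S.Nonempty)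
    (h5 : 2 * S.card ≤ n) :
    conductance (uniformDist n) (homogeneousChain qc ql r d E) <
      16 * qc / c * ((n : ℝ) ^ (1 - α) / Real.log n) := by
  have hn0 : (0 : ℝ) < n := by exact_mod_cast (by omega : 0 < n)
  have hS0 : (0 : ℝ) < S.card := by exact_mod_cast h4.card_pos
  have hS' : S ≠ Finset.univ := by
    rintro rfl
    rw [Finset.card_univ, Fintype.card_fin] at h5
    omega
  have hcompl : (n : ℝ) / 2 ≤ Sᶜ.card := by
    have h : S.card + Sᶜ.card = n := by simp
    have h' : (S.card : ℝ) + Sᶜ.card = n := by exact_mod_cast h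
    have h5' : (2 : ℝ) * S.card ≤ n := by exact_mod_cast h5
    linarith
  refine (conductance_le _ _ h4 hS').trans_lt ?_
  rw [flow_div_eq, h2]
  have h1' : ((exits S).card : ℝ) ≤ 1 := by exact_mod_cast h1
  have hpow : (n : ℝ) ^ (1 - α) = ((n : ℝ) ^ (α - 1))⁻¹ := by
    rw [← Real.rpow_neg hn0.le]
    ring_nf
  have hx : 0 < (n : ℝ) ^ (α - 1) := Real.rpow_pos_of_pos hn0 _
  calc n * (2 * qc * (exits S).card + ql / d * (∅ : Finset (Sym2 (Fin n))).card) /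
        (S.card * Sᶜ.card : ℝ)
      ≤ n * (2 * qc * 1 + 0) / (c / 2 * ((n : ℝ) ^ (α - 1) * Real.log n) * (n / 2)) := by
        simp only [Finset.card_empty, Nat.cast_zero, mul_zero]
        gcongr
    _ = 8 * qc / c * ((n : ℝ) ^ (1 - α) / Real.log n) := by
        rw [hpow]
        field_simp
        ring
    _ < _ := by
        rw [hpow]
        gcongr
        norm_num

/-- An endpoint of any edge has degree at least 1; this gives the d ≥ 1 used in the lower bound. -/
theorem one_le_of_forall_longDegree_le {n : ℕ} {E : Finset (Sym2 (Fin n))} (hE : E.Nonempty)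
    {d : ℝ} (hd : ∀ i, (longDegree E i : ℝ) ≤ d) : 1 ≤ d := by
  obtain ⟨e, he⟩ := hE
  induction e with
  | _ a b =>
    refine le_trans ?_ (hd a)
    rw [Nat.one_le_cast, longDegree]
    exact Finset.card_pos.2 ⟨s(a, b), by simp [he]⟩

end CycleM2

theorem mainTheorem5 (qc ql : ℝ) (hqc : 0 < qc) (hql : 0 < ql) (hq : 2 * qc + ql ≤ 1) :
    ∃ c₁ : ℝ, 0 < c₁ ∧ ∀ α : ℝ, 1 < α → α < 2 →
      (∃ d : ℝ, CycleM2.IsDegreeBoundM2 α d) ∧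
      ∃ c₂ : ℝ, 0 < c₂ ∧ ∀ d : ℝ, CycleM2.IsDegreeBoundM2 α d → ∀ r : ℝ, |r| ≤ qc →
        CycleM2.AasM2 α fun n E =>
          CycleM2.homogeneousChain qc ql r d E ∈ doublyStochastic ℝ (Fin n) ∧
          c₁ * d⁻¹ * ((n : ℝ) ^ (1 - α) / Real.log n) <
            CycleM2.conductance (CycleM2.uniformDist n)
              (CycleM2.homogeneousChain qc ql r d E) ∧
          CycleM2.conductance (CycleM2.uniformDist n)
              (CycleM2.homogeneousChain qc ql r d E) <
            c₂ * ((n : ℝ) ^ (1 - α) / Real.log n) := by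
  have hq0 : 0 < min (2 * qc) ql := lt_min (by linarith) hql
  refine ⟨min (2 * qc) ql / 12, by positivity, fun α hα hα2 =>
    ⟨CycleM2.exists_isDegreeBoundM2 hα hα2, ?_⟩⟩
  -- The largest arc constant allowed by `aasM2_exists_arc`, and the source of the dependence of c₂
  -- on α.
  have hc : 0 < (2 - α) / 64 := by linarith
  refine ⟨16 * qc / ((2 - α) / 64), by positivity, fun d hd r hr => ?_⟩
  have hne := CycleM2.eventually_sampleM2_nonempty hα hα2
  have harc := CycleM2.aasM2_exists_arc hα hα2 hc (by linarith)
  refine ((hd.and (CycleM2.aasM2_card_exits_add_card_inter_cut hα hα2) hne).and harc hne).mono ?_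
  filter_upwards [CycleM2.eventually_log_le hα2] with n ⟨hn, hlog, _, _, hm⟩ E hE ⟨⟨h1, h2⟩, h3⟩
  have : NeZero n := ⟨by omega⟩
  obtain ⟨hEU, hEm⟩ := CycleM2.mem_sampleM2.1 hE
  have hd1 : 1 ≤ d :=
    CycleM2.one_le_of_forall_longDegree_le (Finset.card_pos.1 (by omega)) h1
  obtain ⟨S, hS1, hS2, hS3, hS4, hS5⟩ := h3 this
  exact ⟨CycleM2.homogeneousChain_mem_doublyStochastic (by omega) hql.le hq hr (by linarith) hEU h1,
    CycleM2.lt_conductance_homogeneousChain hn hqc hql hd1 hlog (h2 this),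
    CycleM2.conductance_homogeneousChain_lt hn hqc hc hlog hS1 hS2 hS3 hS4 hS5⟩
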